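/- **Setting.** The parameters are $x=(X_1,\dots,X_{N_L})\in\mathbb R^d$ with $N_L\ge1$ weight matrices $X_\ell\in\mathbb R^{m_\ell\times n_\ell}$, $d=\sum_\ell m_\ell n_\ell$, with the Euclidean norm; $\nabla_\ell$ is the gradient with respect to $X_\ell$. The objective is $f(x)=\mathbb E_{\xi\sim\mathcal D}F(x;\xi)$. Assume $f$ is bounded below; $f$ is differentiable with $\|\nabla f(x)-\nabla f(y)\|_2\le L\|x-y\|_2$ for all $x,y$, where $L>0$; and, for every $x$ and $\ell$, $\mathbb E_\xi[\nabla_\ell F(x;\xi)]=\nabla_\ell f(x)$ and $\mathbb E_\xi\|\nabla_\ell F(x;\xi)-\nabla_\ell f(x)\|_F^2\le\sigma_\ell^2$, with $\sigma_\ell\ge 0$. Put $\sigma=\sqrt{\sum_\ell\sigma_\ell^2}$, $\Delta=f(x^{(0)})-\inf f$ and $\underline\delta=\min_\ell r_\ell/\min\{m_\ell,n_\ell\}$, where $1\le r_\ell\le\min\{m_\ell,n_\ell\}$ are the projection ranks. **Algorithm** (large-batch GaLore using momentum SGD with momentum projection; momentum parameter $\beta_1$, learning rate $\eta$, period $\tau$,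 batch size $\mathcal B$). Start from $x^{(0)}$ with zero momentum. In iteration $t$: if $\tau\mid t$, draw fresh i.i.d. samples $\xi^{(t,1)},\dots,\xi^{(t,\mathcal B)}\sim\mathcal D$, set $G_\ell=\frac1{\mathcal B}\sum_b\nabla_\ell F(x^{(t)};\xi^{(t,b)})$, take a singular value decomposition $G_\ell=U\Sigma V^\top$ (singular values in nonincreasing order), and set $P_\ell^{(t)}=U[:,:r_\ell]$ if $m_\ell\le n_\ell$, or $Q_\ell^{(t)}=V[:,:r_\ell]$ if $m_\ell>n_\ell$; if $\tau\nmid t$, draw one fresh sample $\xi^{(t)}\sim\mathcal D$, set $G_\ell=\nabla_\ell F(x^{(t)};\xi^{(t)})$ and keep $P_\ell^{(t)}=P_\ell^{(t-1)}$, $Q_\ell^{(t)}=Q_\ell^{(t-1)}$. For $m_\ell\le n_\ell$ let $$M_\ell^{(t)}=(1-\beta_1)(P_\ell^{(t)})^\top P_\ell^{(t-1)}M_\ell^{(t-1)}+\beta_1(P_\ell^{(t)})^\top G_\ell,\qquad X_\ell^{(t+1)}=X_\ell^{(t)}-\eta P_\ell^{(t)}M_\ell^{(t)},$$ and for $m_\ell>n_\ell$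 let $$M_\ell^{(t)}=(1-\beta_1)M_\ell^{(t-1)}(Q_\ell^{(t-1)})^\top Q_\ell^{(t)}+\beta_1G_\ell Q_\ell^{(t)},\qquad X_\ell^{(t+1)}=X_\ell^{(t)}-\eta M_\ell^{(t)}(Q_\ell^{(t)})^\top.$$ (If $\tau\nmid t$, the factors $(P_\ell^{(t)})^\top P_\ell^{(t-1)}$ and $(Q_\ell^{(t-1)})^\top Q_\ell^{(t)}$ are the identity.) **Theorem.** (i) If $0<\beta_1\le1$, $\tau\ge\frac{64}{3\beta_1\underline\delta}$, $\mathcal B\ge1$ and $0<\eta\le\min\Big\{\frac1{4L},\sqrt{\frac{3\underline\delta\beta_1^2}{80L^2}},\sqrt{\frac{\underline\delta}{40\tau^2L^2}},\sqrt{\frac{3\beta_1}{32\tau L^2}}\Big\}$, then for every integer $K\ge1$ $$\frac1{K\tau}\sum_{t=0}^{K\tau-1}\mathbb E\|\nabla f(x^{(t)})\|_2^2\le\frac{16\Delta}{\underline\delta\eta K\tau}+\Big(\frac{160}{3\beta_1\underline\delta\tau\mathcal B}+\frac{352}{3\underline\delta^2\mathcal B}+\frac{32\beta_1}{3\underline\delta}\Big)\sigma^2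 .$$ There is moreover an absolute constant $C>0$, independent of all the data, such that (ii) and (iii) hold whenever $\Delta>0$. (ii) If the integer $T$ satisfies $T\ge2+\frac{128}{3\underline\delta}+\frac{(128\sigma)^2}{9\sqrt{\underline\delta}L\Delta}$ and $$\beta_1=\Big(1+\sqrt{\tfrac{\underline\delta^{3/2}\sigma^2T}{L\Delta}}\Big)^{-1},\quad \tau=\Big\lceil\tfrac{64}{3\underline\delta\beta_1}\Big\rceil,\quad \mathcal B=\Big\lceil\tfrac1{\underline\delta\beta_1}\Big\rceil,\quad \eta=\Big(4L+\sqrt{\tfrac{80L^2}{3\underline\delta\beta_1^2}}+\sqrt{\tfrac{40\tau^2L^2}{\underline\delta}}+\sqrt{\tfrac{32\tau L^2}{3\beta_1}}\Big)^{-1},$$ then $$\frac1T\sum_{t=0}^{T-1}\mathbb E\|\nabla f(x^{(t)})\|_2^2\le C\Big(\frac{L\Delta}{\underline\delta^{5/2}T}+\sqrt{\frac{L\Delta\sigma^2}{\underline\delta^{7/2}T}}\Big).$$ (iii) For every $\varepsilon>0$ there is a $T$ as in (ii) for which the algorithm with the hyperparameters of (ii) satisfies $\frac1T\sum_{t=0}^{T-1}\mathbb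 E\|\nabla f(x^{(t)})\|_2^2\le\varepsilon$ and evaluates in its $T$ iterations altogether at most $$C\Big(\frac{L\Delta\sigma^2}{\underline\delta^{7/2}\varepsilon^2}+\frac{L\Delta}{\underline\delta^{5/2}\varepsilon}+\frac{\sigma^2}{\underline\delta^{1/2}L\Delta}+\frac1{\underline\delta}\Big)$$ stochastic gradients $\nabla F(x;\xi)$. -/

import Mathlib

open MeasureTheory ProbabilityTheory

noncomputable section

namespace GaLore

/-- Shapes of the model: `N ≥ 1` weight matrices, the `ℓ`-th of size `m ℓ × n ℓ`, together with
the projection ranks `1 ≤ r ℓ ≤ min (m ℓ) (n ℓ)`. -/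
structure Arch where
  N : ℕ
  m : Fin N → ℕ
  n : Fin N → ℕ
  r : Fin N → ℕ
  N_pos : 0 < N
  r_pos : ∀ l, 0 < r l
  r_le : ∀ l, r l ≤ min (m l) (n l)

/-- The parameter space `ℝ^d`, `d = ∑ m ℓ * n ℓ`, with the Euclidean norm; the coordinate
`⟨ℓ, i, j⟩` is the entry `(i, j)` of the `ℓ`-th weight matrix. -/
abbrev Arch.Params (A : Arch) : Type :=
  EuclideanSpace ℝ (Σ l : Fin A.N, Fin (A.m l) × Fin (A.n l))

/-- The `ℓ`-th weight matrix of a parameter vector. -/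
def layer {A : Arch} (x : A.Params) (l : Fin A.N) : Matrix (Fin (A.m l)) (Fin (A.n l)) ℝ :=
  Matrix.of fun i j => x ⟨l, i, j⟩

/-- The parameter vector with given weight matrices. -/
def ofLayers {A : Arch} (X : ∀ l : Fin A.N, Matrix (Fin (A.m l)) (Fin (A.n l)) ℝ) : A.Params :=
  WithLp.toLp 2 fun p => X p.1 p.2.1 p.2.2

/-- Relative rank `δ_ℓ = r_ℓ / min {m_ℓ, n_ℓ}`. -/
def Arch.delta (A : Arch) (l : Fin A.N) : ℝ := (A.r l : ℝ) / (min (A.m l) (A.n l) : ℕ)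

/-- The smallest relative rank `min_ℓ δ_ℓ`. -/
def Arch.minDelta (A : Arch) : ℝ := ⨅ l, A.delta l

/-- Squared Frobenius norm. -/
def frobSq {m n : ℕ} (G : Matrix (Fin m) (Fin n) ℝ) : ℝ := ∑ i, ∑ j, G i j ^ 2

/-! ### The optimization problem -/

/-- The objective `f x = 𝔼_{ξ ∼ D} F (x; ξ)`. -/
def objective {A : Arch} {Ξ : Type*} [MeasurableSpace Ξ] (D : Measure Ξ) (F : A.Params → Ξ → ℝ) :
    A.Params → ℝ :=
  fun x => ∫ z, F x z ∂D

/-- Lower boundedness. -/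
def LowerBounded {A : Arch} (f : A.Params → ℝ) : Prop := BddBelow (Set.range f)

/-- `L`-smoothness. -/
def LSmooth {A : Arch} (f : A.Params → ℝ) (L : ℝ) : Prop :=
  Differentiable ℝ f ∧ ∀ x y, ‖gradient f x - gradient f y‖ ≤ L * ‖x - y‖

/-- The layer gradient `∇_ℓ f (x)`. -/
def layerGrad {A : Arch} (f : A.Params → ℝ) (x : A.Params) (l : Fin A.N) :
    Matrix (Fin (A.m l)) (Fin (A.n l)) ℝ :=
  layer (gradient f x) l

/-- The sample loss `F` is measurable and integrable in the sample and differentiable in the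
parameters, and its layer gradients are unbiased with variance at most `σ_ℓ²`.
(Integrability of the entries of `∇_ℓ F (x; ξ)` follows from that of the variance integrand.) -/
structure StochasticGradient {A : Arch} {Ξ : Type*} [MeasurableSpace Ξ] (D : Measure Ξ)
    (F : A.Params → Ξ → ℝ) (σ : Fin A.N → ℝ) : Prop where
  measurable : ∀ x, Measurable (F x)
  integrable : ∀ x, Integrable (F x) D
  differentiable : ∀ z, Differentiable ℝ fun x => F x z
  unbiased : ∀ x l i j,
    ∫ z, layerGrad (fun y => F y z) x l i j ∂D = layerGrad (objective D F) x l i j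
  variance_integrable : ∀ x l, Integrable
    (fun z => frobSq (layerGrad (fun y => F y z) x l - layerGrad (objective D F) x l)) D
  variance_le : ∀ x l,
    ∫ z, frobSq (layerGrad (fun y => F y z) x l - layerGrad (objective D F) x l) ∂D ≤ σ l ^ 2

/-- Total noise level `σ = √(∑ σ_ℓ²)`. -/
def totalSigma {A : Arch} (σ : Fin A.N → ℝ) : ℝ := Real.sqrt (∑ l, σ l ^ 2)

/-- Initial gap `Δ = f (x⁰) - inf f`. -/
def gap {A : Arch} (f : A.Params → ℝ) (x0 : A.Params) : ℝ := f x0 - ⨅ x, f x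

/-! ### Singular value decomposition -/

/-- Candidate factors `(U, Σ, V)` of a decomposition `G = U Σ Vᵀ`. -/
structure SVDFactors (m n : ℕ) where
  U : Matrix (Fin m) (Fin m) ℝ
  S : Matrix (Fin m) (Fin n) ℝ
  V : Matrix (Fin n) (Fin n) ℝ

/-- `s` is a singular value decomposition of `G`: `U` and `V` are orthogonal, `G = U Σ Vᵀ`, and
`Σ` is rectangular diagonal with nonnegative, nonincreasing diagonal. -/
structure IsSVD {m n : ℕ} (G : Matrix (Fin m) (Fin n) ℝ) (s : SVDFactors m n) : Prop where
  orthogonal_U : s.U ∈ Matrix.orthogonalGroup (Fin m) ℝ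
  orthogonal_V : s.V ∈ Matrix.orthogonalGroup (Fin n) ℝ
  eq_mul : G = s.U * s.S * s.V.transpose
  diag : ∀ (i : Fin m) (j : Fin n), (i : ℕ) ≠ j → s.S i j = 0
  nonneg : ∀ (i : Fin m) (j : Fin n), 0 ≤ s.S i j
  antitone : ∀ (i i' : Fin m) (j j' : Fin n), (i : ℕ) = j → (i' : ℕ) = j' → i ≤ i' →
    s.S i' j' ≤ s.S i j

/-- A rule that chooses a decomposition for each iteration, layer and matrix. -/
abbrev SVDRule (A : Arch) : Type :=
  ℕ → ∀ l : Fin A.N, Matrix (Fin (A.m l)) (Fin (A.n l)) ℝ → SVDFactors (A.m l) (A.n l)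

/-- The rule always returns a singular value decomposition, and the entries of its singular
vectors are Borel functions of the entries of the decomposed matrix. -/
structure SVDRule.Valid {A : Arch} (svd : SVDRule A) : Prop where
  isSVD : ∀ t l G, IsSVD G (svd t l G)
  measurable_U : ∀ t l i k, Measurable
    fun G : Fin (A.m l) → Fin (A.n l) → ℝ => (svd t l (Matrix.of G)).U i k
  measurable_V : ∀ t l j k, Measurable
    fun G : Fin (A.m l) → Fin (A.n l) → ℝ => (svd t l (Matrix.of G)).V j k

/-- The first `r` columns `U[:, :r]`. -/
def firstCols {m r : ℕ} (h : r ≤ m) (U : Matrix (Fin m) (Fin m) ℝ) : Matrix (Fin m) (Fin r) ℝ :=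
  U.submatrix id (Fin.castLE h)

/-! ### The algorithm -/

/-- Hyperparameters: momentum parameter `β`, learning rate `η`, subspace changing frequency `τ`,
large batch size `B`. -/
structure Hyper where
  β : ℝ
  η : ℝ
  τ : ℕ
  B : ℕ

/-- Memory kept for one layer between iterations: the projection matrices and the momentum. For
`m ≤ n` only `P` and `Mleft` are used, for `m > n` only `Q` and `Mright`. -/
structure LayerMem (m n r : ℕ) where
  P : Matrix (Fin m) (Fin r) ℝ
  Q : Matrix (Fin n) (Fin r) ℝ
  Mleft : Matrix (Fin r) (Fin n) ℝ
  Mright : Matrix (Fin m) (Fin r) ℝ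

/-- State at the beginning of an iteration. -/
structure State (A : Arch) where
  x : A.Params
  mem : ∀ l : Fin A.N, LayerMem (A.m l) (A.n l) (A.r l)

/-- Initial state: momentum zero. (The projections held before the first switch are irrelevant,
as they only multiply the zero momentum.) -/
def initState {A : Arch} (x0 : A.Params) : State A where
  x := x0
  mem := fun _ => ⟨0, 0, 0, 0⟩

/-- Number of stochastic gradients evaluated in iteration `t`. -/
def Hyper.batch (H : Hyper) (t : ℕ) : ℕ := if t % H.τ = 0 then H.B else 1

/-- The gradient estimate `G_ℓ` of iteration `t` at `x` from the samples `z 0, z 1, …`: the average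
over the `B` samples `z 0, …, z (B - 1)` at a subspace switch, the single sample `z 0` otherwise. -/
def gradEst {A : Arch} {Ξ : Type*} (H : Hyper) (F : A.Params → Ξ → ℝ) (t : ℕ) (x : A.Params)
    (z : ℕ → Ξ) (l : Fin A.N) : Matrix (Fin (A.m l)) (Fin (A.n l)) ℝ :=
  if t % H.τ = 0 then
    (1 / (H.B : ℝ)) • ∑ b ∈ Finset.range H.B, layerGrad (fun y => F y (z b)) x l
  else layerGrad (fun y => F y (z 0)) x l

/-- Update of projection and momentum of one layer in iteration `t`, given the gradient estimate
`G` and its decomposition `s` (used only when the subspace switches). -/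
def updateMem {m n r : ℕ} (h : r ≤ min m n) (H : Hyper) (t : ℕ) (G : Matrix (Fin m) (Fin n) ℝ)
    (s : SVDFactors m n) (c : LayerMem m n r) : LayerMem m n r :=
  if t % H.τ = 0 then
    if m ≤ n then
      let P := firstCols (h.trans (min_le_left m n)) s.U
      { c with
        P := P
        Mleft := (1 - H.β) • (P.transpose * c.P * c.Mleft) + H.β • (P.transpose * G) }
    else
      let Q := firstCols (h.trans (min_le_right m n)) s.V
      { c with
        Q := Q
        Mright := (1 - H.β) • (c.Mright * c.Q.transpose * Q) + H.β • (G * Q) }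
  else
    if m ≤ n then
      { c with Mleft := (1 - H.β) • c.Mleft + H.β • (c.P.transpose * G) }
    else
      { c with Mright := (1 - H.β) • c.Mright + H.β • (G * c.Q) }

/-- The momentum mapped back to the full space: `P M` if `m ≤ n`, and `M Qᵀ` if `m > n`. -/
def LayerMem.direction {m n r : ℕ} (c : LayerMem m n r) : Matrix (Fin m) (Fin n) ℝ :=
  if m ≤ n then c.P * c.Mleft else c.Mright * c.Q.transpose

/-- One iteration of large-batch GaLore with momentum SGD and momentum projection. -/
def step {A : Arch} {Ξ : Type*} (H : Hyper) (F : A.Params → Ξ → ℝ) (svd : SVDRule A) (t : ℕ)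
    (z : ℕ → Ξ) (s : State A) : State A :=
  let mem' := fun l =>
    let G := gradEst H F t s.x z l
    updateMem (A.r_le l) H t G (svd t l G) (s.mem l)
  { x := ofLayers fun l => layer s.x l - H.η • (mem' l).direction
    mem := mem' }

/-- The state before iteration `t`, started at `x0` and run on the samples `z t b`. -/
def run {A : Arch} {Ξ : Type*} (H : Hyper) (F : A.Params → Ξ → ℝ) (svd : SVDRule A)
    (x0 : A.Params) (z : ℕ → ℕ → Ξ) : ℕ → State A
  | 0 => initState x0
  | t + 1 => step H F svd t (z t) (run H F svd x0 z t)

/-- The iterate `x^(t)` as a random variable. -/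
def iterate {A : Arch} {Ξ Ω : Type*} (H : Hyper) (F : A.Params → Ξ → ℝ) (svd : SVDRule A)
    (x0 : A.Params) (ξ : ℕ → ℕ → Ω → Ξ) (t : ℕ) (ω : Ω) : A.Params :=
  (run H F svd x0 (fun s b => ξ s b ω) t).x

/-- The samples `ξ t b` are independent with common law `D`. -/
structure IIDSamples {Ξ Ω : Type*} [MeasurableSpace Ξ] [MeasurableSpace Ω] (D : Measure Ξ)
    (μ : Measure Ω) (ξ : ℕ → ℕ → Ω → Ξ) : Prop where
  measurable : ∀ t b, Measurable (ξ t b)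
  law : ∀ t b, μ.map (ξ t b) = D
  indep : iIndepFun (fun p : ℕ × ℕ => ξ p.1 p.2) μ

/-- `(1/T) ∑_{t<T} 𝔼 ‖∇f (x^(t))‖² ≤ bound`, all the expectations being finite. -/
def AvgGradSqLE {A : Arch} {Ω : Type*} [MeasurableSpace Ω] (μ : Measure Ω) (f : A.Params → ℝ)
    (X : ℕ → Ω → A.Params) (T : ℕ) (bound : ℝ) : Prop :=
  (∀ t < T, Integrable (fun ω => ‖gradient f (X t ω)‖ ^ 2) μ) ∧
    (1 / (T : ℝ)) * ∑ t ∈ Finset.range T, ∫ ω, ‖gradient f (X t ω)‖ ^ 2 ∂μ ≤ bound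

/-- Number of stochastic gradients evaluated in the first `T` iterations. -/
def Hyper.gradEvals (H : Hyper) (T : ℕ) : ℕ := ∑ t ∈ Finset.range T, H.batch t

/-- Hyperparameters chosen for the horizon `T`. -/
def hyperFor (δ L Δ σ : ℝ) (T : ℕ) : Hyper :=
  let β : ℝ := (1 + Real.sqrt (δ ^ (3 / 2 : ℝ) * σ ^ 2 * T / (L * Δ)))⁻¹
  let τ : ℕ := ⌈64 / (3 * δ * β)⌉₊
  { β := β
    τ := τ
    η := (4 * L + Real.sqrt (80 * L ^ 2 / (3 * δ * β ^ 2)) +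
      Real.sqrt (40 * (τ : ℝ) ^ 2 * L ^ 2 / δ) + Real.sqrt (32 * (τ : ℝ) * L ^ 2 / (3 * β)))⁻¹
    B := ⌈1 / (δ * β)⌉₊ }

/-- The horizon is long enough. -/
def LongHorizon (δ L Δ σ : ℝ) (T : ℕ) : Prop :=
  2 + 128 / (3 * δ) + (128 * σ) ^ 2 / (9 * Real.sqrt δ * L * Δ) ≤ (T : ℝ)

end GaLore

end

/-!
Fix a layer. Truncating a singular value decomposition of the large-batch gradient estimate at rank
`r` keeps at least the fraction `r / min m n ≥ δ` of its energy. As the iterates drift little within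
a period, the same projection loses at most `(1 - δ / 2) ‖∇f‖²`, plus drift and noise of order
`1 / δ`, at every later iteration of the period. Inside the projected subspace the momentum is a
moving average: its error contracts by `1 - β` in each iteration, up to drift and noise, and only
the change of subspace at the one switch per period adds to it a term of size `‖∇f‖²`. Since
`τ ≥ 64 / (3 β δ)`, these terms are dominated by the captured energy `δ ‖∇f‖²`, and the descent
lemma for `L`-smooth functions, summed over the iterations, gives the bound for `K` periods.

A horizon `T` that is not a multiple of `τ` is completed to whole periods with at most `2 T`
iterations, which at most doubles the average.
-/

namespace GaLore

open scoped NNReal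

/-! ### Mean squares -/

section MeanSq

variable {Ω E F G : Type*} [mΩ : MeasurableSpace Ω] [NormedAddCommGroup E] [NormedAddCommGroup F]
  [NormedAddCommGroup G] {μ : Measure Ω}

/-- The mean square `𝔼 ‖u‖²` of a random vector. It is `0` if `u` is not square integrable, so
upper bounds on it are accompanied by `MemLp u 2 μ`. -/
noncomputable def meanSq (μ : Measure Ω) (u : Ω → E) : ℝ := ∫ ω, ‖u ω‖ ^ 2 ∂μ

theorem meanSq_nonneg (u : Ω → E) : 0 ≤ meanSq μ u :=
  integral_nonneg fun _ => sq_nonneg _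

theorem integrable_norm_sq {u : Ω → E} (hu : MemLp u 2 μ) : Integrable (fun ω => ‖u ω‖ ^ 2) μ :=
  hu.integrable_norm_pow two_ne_zero

theorem meanSq_le_of_norm_sq_le_add {u : Ω → E} {v : Ω → F} {w : Ω → G} {a b : ℝ}
    (hv : MemLp v 2 μ) (hw : MemLp w 2 μ)
    (h : ∀ ω, ‖u ω‖ ^ 2 ≤ a * ‖v ω‖ ^ 2 + b * ‖w ω‖ ^ 2) :
    meanSq μ u ≤ a * meanSq μ v + b * meanSq μ w := by
  have hv' := (integrable_norm_sq hv).const_mul a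
  have hw' := (integrable_norm_sq hw).const_mul b
  calc meanSq μ u ≤ ∫ ω, (a * ‖v ω‖ ^ 2 + b * ‖w ω‖ ^ 2) ∂μ :=
        integral_mono_of_nonneg (.of_forall fun _ => sq_nonneg _) (hv'.add hw') (.of_forall h)
    _ = a * meanSq μ v + b * meanSq μ w := by
        rw [integral_add hv' hw', integral_const_mul, integral_const_mul, meanSq, meanSq]

theorem meanSq_le_of_norm_le_mul {u : Ω → E} {v : Ω → F} {c : ℝ} (hv : MemLp v 2 μ)
    (h : ∀ ω, ‖u ω‖ ≤ c * ‖v ω‖) : meanSq μ u ≤ c ^ 2 * meanSq μ v := by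
  have hsq : ∀ ω, ‖u ω‖ ^ 2 ≤ c ^ 2 * ‖v ω‖ ^ 2 + 0 * ‖v ω‖ ^ 2 := fun ω => by
    rw [zero_mul, add_zero, ← mul_pow]
    exact pow_le_pow_left₀ (norm_nonneg _) (h ω) 2
  simpa using meanSq_le_of_norm_sq_le_add hv hv hsq

theorem meanSq_mono {u : Ω → E} {v : Ω → F} (hv : MemLp v 2 μ) (h : ∀ ω, ‖u ω‖ ≤ ‖v ω‖) :
    meanSq μ u ≤ meanSq μ v := by
  simpa using meanSq_le_of_norm_le_mul (c := 1) hv (by simpa using h)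

theorem meanSq_const_smul [NormedSpace ℝ E] (c : ℝ) (u : Ω → E) :
    meanSq μ (c • u) = c ^ 2 * meanSq μ u := by
  simp only [meanSq, Pi.smul_apply, norm_smul, mul_pow, Real.norm_eq_abs, sq_abs,
    integral_const_mul]

theorem norm_add_sq_le_weighted {c : ℝ} (hc : 0 < c) (u v : E) :
    ‖u + v‖ ^ 2 ≤ (1 + c) * ‖u‖ ^ 2 + (1 + 1 / c) * ‖v‖ ^ 2 := by
  have young : 2 * ‖u‖ * ‖v‖ ≤ c * ‖u‖ ^ 2 + 1 / c * ‖v‖ ^ 2 := by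
    have : c * ‖u‖ ^ 2 + 1 / c * ‖v‖ ^ 2 - 2 * ‖u‖ * ‖v‖ = (c * ‖u‖ - ‖v‖) ^ 2 / c := by
      field_simp; ring
    linarith [show 0 ≤ (c * ‖u‖ - ‖v‖) ^ 2 / c by positivity]
  calc ‖u + v‖ ^ 2 ≤ (‖u‖ + ‖v‖) ^ 2 := by gcongr; exact norm_add_le u v
    _ ≤ _ := by linarith

theorem meanSq_add_le_two {u v : Ω → E} (hu : MemLp u 2 μ) (hv : MemLp v 2 μ) :
    meanSq μ (u + v) ≤ 2 * meanSq μ u + 2 * meanSq μ v :=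
  meanSq_le_of_norm_sq_le_add hu hv fun ω =>
    (norm_add_sq_le_weighted one_pos (u ω) (v ω)).trans_eq (by norm_num)

theorem meanSq_sum_range_le {u : ℕ → Ω → E} {r τ : ℕ} (hr : r ≤ τ) (hu : ∀ i, MemLp (u i) 2 μ) :
    meanSq μ (∑ i ∈ Finset.range r, u i) ≤ τ * ∑ i ∈ Finset.range τ, meanSq μ (u i) := by
  have hint : ∀ i ∈ Finset.range τ, Integrable (fun ω => ‖u i ω‖ ^ 2) μ := fun i _ =>
    integrable_norm_sq (hu i)
  simp only [meanSq]
  rw [← integral_finsetSum _ hint, ← integral_const_mul]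
  refine integral_mono_of_nonneg (.of_forall fun _ => sq_nonneg _)
    ((integrable_finsetSum _ hint).const_mul _) (.of_forall fun ω => ?_)
  calc ‖(∑ i ∈ Finset.range r, u i) ω‖ ^ 2 ≤ (∑ i ∈ Finset.range r, ‖u i ω‖) ^ 2 := by
        rw [Finset.sum_apply]; gcongr; exact norm_sum_le _ _
    _ ≤ (Finset.range r).card * ∑ i ∈ Finset.range r, ‖u i ω‖ ^ 2 := sq_sum_le_card_mul_sum_sq
    _ ≤ τ * ∑ i ∈ Finset.range τ, ‖u i ω‖ ^ 2 := by rw [Finset.card_range]; gcongr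

theorem integrable_inner_of_memLp [InnerProductSpace ℝ E] {u v : Ω → E} (hu : MemLp u 2 μ)
    (hv : MemLp v 2 μ) : Integrable (fun ω => inner ℝ (u ω) (v ω)) μ := by
  refine (L2.integrable_inner (𝕜 := ℝ) hu.toLp hv.toLp).congr ?_
  filter_upwards [hu.coeFn_toLp, hv.coeFn_toLp] with ω hu' hv'
  rw [hu', hv']

theorem meanSq_add_of_integral_inner_eq_zero [InnerProductSpace ℝ E] {u v : Ω → E}
    (hu : MemLp u 2 μ) (hv : MemLp v 2 μ) (h : ∫ ω, inner ℝ (u ω) (v ω) ∂μ = 0) :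
    meanSq μ (u + v) = meanSq μ u + meanSq μ v := by
  have hu' := integrable_norm_sq hu
  have huv := (integrable_inner_of_memLp hu hv).const_mul 2
  simp only [meanSq, Pi.add_apply, norm_add_sq_real]
  rw [integral_add (by exact hu'.add huv) (integrable_norm_sq hv), integral_add hu' huv,
    integral_const_mul, h, mul_zero, add_zero]

end MeanSq

section MemL2

variable {Ω E F : Type*} [NormedAddCommGroup E] [NormedAddCommGroup F]

/-- Square integrable random vectors that are known given the `σ`-algebra `m`; for a filtration
`ℱ`, `MemL2 (ℱ t) μ u` says that `u` is determined by the first `t` iterations. -/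
structure MemL2 (m : MeasurableSpace Ω) {mΩ : MeasurableSpace Ω} (μ : Measure Ω) (u : Ω → E) :
    Prop where
  stronglyMeasurable : StronglyMeasurable[m] u
  memLp : MemLp u 2 μ

namespace MemL2

variable {m m' mΩ : MeasurableSpace Ω} {μ : Measure Ω} {u v : Ω → E}

theorem mono (hu : MemL2 m μ u) (h : m ≤ m') : MemL2 m' μ u :=
  ⟨hu.stronglyMeasurable.mono h, hu.memLp⟩

theorem const [IsFiniteMeasure μ] (c : E) : MemL2 m μ fun _ => c :=
  ⟨stronglyMeasurable_const, memLp_const c⟩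

theorem add (hu : MemL2 m μ u) (hv : MemL2 m μ v) : MemL2 m μ (u + v) :=
  ⟨hu.stronglyMeasurable.add hv.stronglyMeasurable, hu.memLp.add hv.memLp⟩

theorem sub (hu : MemL2 m μ u) (hv : MemL2 m μ v) : MemL2 m μ (u - v) :=
  ⟨hu.stronglyMeasurable.sub hv.stronglyMeasurable, hu.memLp.sub hv.memLp⟩

theorem const_smul [NormedSpace ℝ E] (hu : MemL2 m μ u) (c : ℝ) : MemL2 m μ (c • u) :=
  ⟨hu.stronglyMeasurable.const_smul c, hu.memLp.const_smul c⟩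

theorem comp_lipschitz [IsFiniteMeasure μ] {K : ℝ≥0} {g : E → F} (hu : MemL2 m μ u)
    (hg : LipschitzWith K g) : MemL2 m μ fun ω => g (u ω) := by
  have hsub : LipschitzWith K fun x => g x - g 0 := by
    simpa only [add_zero] using hg.sub (LipschitzWith.const (g 0))
  have hL2 := (hsub.comp_memLp (sub_self _) hu.memLp).add (memLp_const (g 0))
  refine ⟨hg.continuous.comp_stronglyMeasurable hu.stronglyMeasurable, hL2.ae_eq ?_⟩
  exact .of_forall fun ω => sub_add_cancel _ _

end MemL2

end MemL2

/-! ### Orthogonal projections and smooth functions -/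

section Hilbert

variable {E : Type*} [NormedAddCommGroup E] [InnerProductSpace ℝ E] {p : E →ₗ[ℝ] E} {u : E}

theorem apply_apply_of_isSymmetricProjection (hp : p.IsSymmetricProjection) (v : E) :
    p (p v) = p v :=
  LinearMap.congr_fun hp.isIdempotentElem.eq v

theorem norm_sub_sq_of_apply_eq_self (hp : p.IsSymmetricProjection) (hu : p u = u) (v : E) :
    ‖v - u‖ ^ 2 = ‖u - p v‖ ^ 2 + ‖v - p v‖ ^ 2 := by
  have orthogonal : inner ℝ (p (u - v)) (v - p v) = 0 := by
    rw [hp.isSymmetric, map_sub, apply_apply_of_isSymmetricProjection hp, sub_self,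
      inner_zero_right]
  rw [map_sub, hu] at orthogonal
  rw [norm_sub_rev v u, ← sub_sub_sub_cancel_right u v (p v), norm_sub_sq_real, orthogonal]
  ring

theorem norm_sq_eq_add_of_isSymmetricProjection (hp : p.IsSymmetricProjection) (v : E) :
    ‖v‖ ^ 2 = ‖p v‖ ^ 2 + ‖v - p v‖ ^ 2 := by
  simpa using norm_sub_sq_of_apply_eq_self hp (map_zero p) v

theorem norm_apply_le_of_isSymmetricProjection (hp : p.IsSymmetricProjection) (v : E) :
    ‖p v‖ ≤ ‖v‖ :=
  le_of_sq_le_sq (by nlinarith [norm_sq_eq_add_of_isSymmetricProjection hp v]) (norm_nonneg _)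

theorem norm_sub_apply_le_of_isSymmetricProjection (hp : p.IsSymmetricProjection) (v : E) :
    ‖v - p v‖ ≤ ‖v‖ :=
  le_of_sq_le_sq (by nlinarith [norm_sq_eq_add_of_isSymmetricProjection hp v]) (norm_nonneg _)

-- A projection adapted to `w` is also adapted to nearby `v`; Young's inequality with weight
-- `δ / 4`, applied twice, leaves half of the captured fraction `δ`.
theorem norm_sub_apply_sq_le_of_capture (hp : p.IsSymmetricProjection) {δ : ℝ} (hδ0 : 0 < δ)
    (hδ1 : δ ≤ 1) {w : E} (hw : ‖w - p w‖ ^ 2 ≤ (1 - δ) * ‖w‖ ^ 2) (v : E) :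
    ‖v - p v‖ ^ 2 ≤ (1 - δ / 2) * ‖v‖ ^ 2 + 8 / δ * ‖v - w‖ ^ 2 := by
  have hδ4 : 0 < δ / 4 := by positivity
  have to_w : ‖v - p v‖ ^ 2 ≤
      (1 + δ / 4) * ‖w - p w‖ ^ 2 + (1 + 1 / (δ / 4)) * ‖v - w‖ ^ 2 := by
    calc ‖v - p v‖ ^ 2 = ‖(w - p w) + ((v - w) - p (v - w))‖ ^ 2 := by
          rw [map_sub]; congr 2; abel
      _ ≤ _ := norm_add_sq_le_weighted hδ4 _ _
      _ ≤ _ := by gcongr; exact norm_sub_apply_le_of_isSymmetricProjection hp _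
  have to_v : ‖w‖ ^ 2 ≤ (1 + δ / 4) * ‖v‖ ^ 2 + (1 + 1 / (δ / 4)) * ‖v - w‖ ^ 2 := by
    calc ‖w‖ ^ 2 = ‖v + (w - v)‖ ^ 2 := by rw [add_sub_cancel]
      _ ≤ _ := norm_add_sq_le_weighted hδ4 _ _
      _ = _ := by rw [norm_sub_rev w v]
  have coeff_v : (1 + δ / 4) * ((1 - δ) * (1 + δ / 4)) ≤ 1 - δ / 2 := by
    nlinarith [mul_pos hδ0 hδ0, mul_pos (mul_pos hδ0 hδ0) hδ0]
  have coeff_dist :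
      (1 + δ / 4) * ((1 - δ) * (1 + 1 / (δ / 4))) + (1 + 1 / (δ / 4)) ≤ 8 / δ := by
    have : 8 / δ - ((1 + δ / 4) * ((1 - δ) * (1 + 1 / (δ / 4))) + (1 + 1 / (δ / 4))) =
        1 + 7 / 4 * δ + δ ^ 2 / 4 := by field_simp; ring
    nlinarith [sq_nonneg δ]
  calc ‖v - p v‖ ^ 2
      ≤ (1 + δ / 4) * ((1 - δ) * ((1 + δ / 4) * ‖v‖ ^ 2 + (1 + 1 / (δ / 4)) * ‖v - w‖ ^ 2)) +
        (1 + 1 / (δ / 4)) * ‖v - w‖ ^ 2 := by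
        refine to_w.trans ?_
        have : 0 ≤ 1 - δ := by linarith
        gcongr
        exact hw.trans (by gcongr)
    _ = (1 + δ / 4) * ((1 - δ) * (1 + δ / 4)) * ‖v‖ ^ 2 +
        ((1 + δ / 4) * ((1 - δ) * (1 + 1 / (δ / 4))) + (1 + 1 / (δ / 4))) * ‖v - w‖ ^ 2 := by ring
    _ ≤ _ := by gcongr

variable [CompleteSpace E] {f : E → ℝ} {L : ℝ≥0}

theorem hasDerivAt_comp_add_smul (hf : Differentiable ℝ f) (x v : E) (t : ℝ) :
    HasDerivAt (fun t : ℝ => f (x + t • v)) (inner ℝ (gradient f (x + t • v)) v) t := by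
  have line : HasDerivAt (fun t : ℝ => x + t • v) v t := by
    simpa using ((hasDerivAt_id t).smul_const v).const_add x
  simpa [Function.comp_def] using
    (hf (x + t • v)).hasGradientAt.hasFDerivAt.comp_hasDerivAt t line

theorem le_add_inner_gradient_add_sq (hf : Differentiable ℝ f) (hL : LipschitzWith L (gradient f))
    (x v : E) : f (x + v) ≤ f x + inner ℝ (gradient f x) v + L / 2 * ‖v‖ ^ 2 := by
  set φ : ℝ → ℝ := fun t => f (x + t • v) - t * inner ℝ (gradient f x) v - L / 2 * ‖v‖ ^ 2 * t ^ 2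
  have hφ : ∀ t, HasDerivAt φ (inner ℝ (gradient f (x + t • v) - gradient f x) v
      - L * ‖v‖ ^ 2 * t) t := fun t => by
    refine (((hasDerivAt_comp_add_smul hf x v t).sub
      ((hasDerivAt_id t).mul_const (inner ℝ (gradient f x) v))).sub
      ((hasDerivAt_pow 2 t).const_mul (L / 2 * ‖v‖ ^ 2))).congr_deriv ?_
    rw [inner_sub_left]
    simp
    ring
  have hφ_anti : AntitoneOn φ (Set.Icc 0 1) := by
    refine antitoneOn_of_deriv_nonpos (convex_Icc 0 1)
      (fun t _ => (hφ t).continuousAt.continuousWithinAt)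
      (fun t _ => (hφ t).differentiableAt.differentiableWithinAt) fun t ht => ?_
    rw [interior_Icc] at ht
    rw [(hφ t).deriv, sub_nonpos]
    calc inner ℝ (gradient f (x + t • v) - gradient f x) v
        ≤ ‖gradient f (x + t • v) - gradient f x‖ * ‖v‖ := real_inner_le_norm _ _
      _ ≤ (L * ‖x + t • v - x‖) * ‖v‖ := by gcongr; exact hL.norm_sub_le _ _
      _ = L * ‖v‖ ^ 2 * t := by
        rw [add_sub_cancel_left, norm_smul, Real.norm_of_nonneg ht.1.le]; ring
  have h01 := hφ_anti (by simp) (by simp) (zero_le_one' ℝ)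
  simp only [φ, one_smul, zero_smul, add_zero] at h01
  linarith

theorem descent_step {η : ℝ} (hf : Differentiable ℝ f) (hL : LipschitzWith L (gradient f))
    (hη : 0 ≤ η) (hηL : η * L ≤ 1 / 4) (x m : E) :
    η / 2 * ‖gradient f x‖ ^ 2 + 3 * η / 8 * ‖m‖ ^ 2 - η / 2 * ‖gradient f x - m‖ ^ 2 ≤
      f x - f (x - η • m) := by
  have quadratic := le_add_inner_gradient_add_sq hf hL x (-(η • m))
  rw [← sub_eq_add_neg, norm_neg, norm_smul, Real.norm_of_nonneg hη, inner_neg_right,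
    inner_smul_right] at quadratic
  rw [norm_sub_sq_real]
  nlinarith [mul_le_mul_of_nonneg_right hηL (mul_nonneg hη (sq_nonneg ‖m‖))]

end Hilbert

/-! ### Momentum descent with random projections -/

theorem sum_range_mul {M : Type*} [AddCommMonoid M] (g : ℕ → M) (K τ : ℕ) :
    ∑ t ∈ Finset.range (K * τ), g t =
      ∑ k ∈ Finset.range K, ∑ r ∈ Finset.range τ, g (k * τ + r) := by
  induction K with
  | zero => simp
  | succ K ih => rw [Finset.sum_range_succ, ← ih, Nat.succ_mul, Finset.sum_range_add]

theorem sum_range_mul_ite_mod_eq_zero {M : Type*} [AddCommMonoid M] (g : ℕ → M) (K : ℕ) {τ : ℕ}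
    (hτ : 0 < τ) :
    ∑ t ∈ Finset.range (K * τ), (if t % τ = 0 then g t else 0) =
      ∑ k ∈ Finset.range K, g (k * τ) := by
  rw [sum_range_mul]
  refine Finset.sum_congr rfl fun k _ => ?_
  rw [Finset.sum_eq_single_of_mem 0 (Finset.mem_range.2 hτ)]
  · simp
  · intro r hr h0
    rw [if_neg]
    rwa [Nat.mul_add_mod', Nat.mod_eq_of_lt (Finset.mem_range.1 hr)]

/-- Momentum descent `m ↦ p ((1 - β) m + β (∇f (X) + noise))`, `X ↦ X - η m` in which every update
is projected, seen as a stochastic process. `X t` and `m t` are the iterate and the momentum,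
mapped back to the full space, before iteration `t`, while `noise t` and `p (t + 1)` are the
gradient noise and the projection of iteration `t`, so that everything indexed by `t`, except the
noise, is known at `ℱ t`. The projection changes only if `τ ∣ t`; it then captures a fraction `δ`
of the energy of the gradient estimate, whose noise level is `N` instead of `s`. -/
structure ProjectedMomentum {Ω : Type*} [mΩ : MeasurableSpace Ω] (μ : Measure Ω) (E : Type*)
    [NormedAddCommGroup E] [InnerProductSpace ℝ E] [CompleteSpace E] where
  f : E → ℝ
  x₀ : E
  L : ℝ≥0
  (β η δ s N : ℝ)
  τ : ℕ
  (X m noise : ℕ → Ω → E)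
  p : ℕ → Ω → E →ₗ[ℝ] E
  ℱ : Filtration ℕ mΩ
  differentiable : Differentiable ℝ f
  lipschitz : LipschitzWith L (gradient f)
  bddBelow : BddBelow (Set.range f)
  β_pos : 0 < β
  β_le_one : β ≤ 1
  δ_pos : 0 < δ
  δ_le_one : δ ≤ 1
  X_zero : ∀ ω, X 0 ω = x₀
  m_zero : ∀ ω, m 0 ω = 0
  p_zero : ∀ ω, p 0 ω = 0
  X_succ : ∀ t ω, X (t + 1) ω = X t ω - η • m (t + 1) ω
  m_succ : ∀ t ω, m (t + 1) ω =
    p (t + 1) ω ((1 - β) • m t ω + β • (gradient f (X t ω) + noise t ω))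
  isSymmetricProjection : ∀ t ω, (p t ω).IsSymmetricProjection
  p_succ : ∀ t ω, t % τ ≠ 0 → p (t + 1) ω = p t ω
  capture : ∀ t ω, t % τ = 0 →
    ‖(gradient f (X t ω) + noise t ω) - p (t + 1) ω (gradient f (X t ω) + noise t ω)‖ ^ 2 ≤
      (1 - δ) * ‖gradient f (X t ω) + noise t ω‖ ^ 2
  stronglyMeasurable_apply : ∀ {i j : ℕ} {v : Ω → E}, i ≤ j → StronglyMeasurable[ℱ j] v →
    StronglyMeasurable[ℱ j] fun ω => p i ω (v ω)
  memL2_noise : ∀ t, MemL2 (ℱ (t + 1)) μ (noise t)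
  integral_inner_noise : ∀ t Y, MemL2 (ℱ t) μ Y → ∫ ω, inner ℝ (Y ω) (noise t ω) ∂μ = 0
  meanSq_noise_le : ∀ t, meanSq μ (noise t) ≤ s
  meanSq_noise_le_of_switch : ∀ t, t % τ = 0 → meanSq μ (noise t) ≤ N

namespace ProjectedMomentum

variable {Ω E : Type*} [MeasurableSpace Ω] {μ : Measure Ω} [NormedAddCommGroup E]
  [InnerProductSpace ℝ E] [CompleteSpace E] (P : ProjectedMomentum μ E)

/-- The gradient at the iterate `X t`. -/
noncomputable def grad (t : ℕ) (ω : Ω) : E := gradient P.f (P.X t ω)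

/-- The part of `∇f (X t) - m (t + 1)` inside the subspace of iteration `t`: the error due to
gradient noise and stale momentum. -/
noncomputable def momentumError (t : ℕ) (ω : Ω) : E := P.m (t + 1) ω - P.p (t + 1) ω (P.grad t ω)

/-- The part of `∇f (X t)` outside the subspace of iteration `t`. -/
noncomputable def projectionError (t : ℕ) (ω : Ω) : E := P.grad t ω - P.p (t + 1) ω (P.grad t ω)

/-- The momentum error before iteration `t`: old momentum and subspace, but the gradient at the new
iterate. -/
noncomputable def laggedError (t : ℕ) (ω : Ω) : E := P.m t ω - P.p t ω (P.grad t ω)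

theorem apply_m (t : ℕ) (ω : Ω) : P.p t ω (P.m t ω) = P.m t ω := by
  cases t with
  | zero => rw [P.m_zero, map_zero]
  | succ t => rw [P.m_succ, apply_apply_of_isSymmetricProjection (P.isSymmetricProjection _ _)]

theorem norm_grad_sub_m_sq (t : ℕ) (ω : Ω) :
    ‖P.grad t ω - P.m (t + 1) ω‖ ^ 2 = ‖P.momentumError t ω‖ ^ 2 + ‖P.projectionError t ω‖ ^ 2 :=
  norm_sub_sq_of_apply_eq_self (P.isSymmetricProjection _ _) (P.apply_m _ _) _

section Integrability

theorem memL2_apply {i j : ℕ} (hij : i ≤ j) {v : Ω → E} (hv : MemL2 (P.ℱ j) μ v) :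
    MemL2 (P.ℱ j) μ fun ω => P.p i ω (v ω) := by
  have hmeas := P.stronglyMeasurable_apply hij hv.stronglyMeasurable
  exact ⟨hmeas, hv.memLp.mono (hmeas.mono (P.ℱ.le j)).aestronglyMeasurable (.of_forall fun _ =>
    norm_apply_le_of_isSymmetricProjection (P.isSymmetricProjection _ _) _)⟩

variable [IsFiniteMeasure μ]

theorem memL2_X_and_m (t : ℕ) : MemL2 (P.ℱ t) μ (P.X t) ∧ MemL2 (P.ℱ t) μ (P.m t) := by
  induction t with
  | zero => rw [funext P.X_zero, funext P.m_zero]; exact ⟨.const _, .const _⟩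
  | succ t ih =>
    have hX := ih.1.mono (P.ℱ.mono t.le_succ)
    have hm : MemL2 (P.ℱ (t + 1)) μ (P.m (t + 1)) := by
      rw [funext (P.m_succ t)]
      exact P.memL2_apply le_rfl (((ih.2.mono (P.ℱ.mono t.le_succ)).const_smul (1 - P.β)).add
        (((hX.comp_lipschitz P.lipschitz).add (P.memL2_noise t)).const_smul P.β))
    rw [funext (P.X_succ t)]
    exact ⟨hX.sub (hm.const_smul P.η), hm⟩

theorem memL2_m (t : ℕ) : MemL2 (P.ℱ t) μ (P.m t) := (P.memL2_X_and_m t).2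

theorem memL2_grad (t : ℕ) : MemL2 (P.ℱ t) μ (P.grad t) :=
  (P.memL2_X_and_m t).1.comp_lipschitz P.lipschitz

theorem memL2_laggedError (t : ℕ) : MemL2 (P.ℱ t) μ (P.laggedError t) :=
  (P.memL2_m t).sub (P.memL2_apply le_rfl (P.memL2_grad t))

theorem memL2_momentumError (t : ℕ) : MemL2 (P.ℱ (t + 1)) μ (P.momentumError t) :=
  (P.memL2_m (t + 1)).sub
    (P.memL2_apply le_rfl ((P.memL2_grad t).mono (P.ℱ.mono t.le_succ)))

theorem memL2_projectionError (t : ℕ) : MemL2 (P.ℱ (t + 1)) μ (P.projectionError t) :=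
  have hgrad := (P.memL2_grad t).mono (P.ℱ.mono t.le_succ)
  hgrad.sub (P.memL2_apply le_rfl hgrad)

end Integrability

section Descent

theorem sum_descent_le_gap (hη : 0 ≤ P.η) (hηL : P.η * P.L ≤ 1 / 4) (T : ℕ) (ω : Ω) :
    ∑ t ∈ Finset.range T, (P.η / 2 * ‖P.grad t ω‖ ^ 2 + 3 * P.η / 8 * ‖P.m (t + 1) ω‖ ^ 2 -
      P.η / 2 * (‖P.momentumError t ω‖ ^ 2 + ‖P.projectionError t ω‖ ^ 2)) ≤
      P.f P.x₀ - ⨅ x, P.f x :=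
  calc _ ≤ ∑ t ∈ Finset.range T, (P.f (P.X t ω) - P.f (P.X (t + 1) ω)) :=
        Finset.sum_le_sum fun t _ => by
          rw [← P.norm_grad_sub_m_sq, P.X_succ]
          exact descent_step P.differentiable P.lipschitz hη hηL _ _
    _ = P.f P.x₀ - P.f (P.X T ω) := by rw [Finset.sum_range_sub', P.X_zero]
    _ ≤ _ := sub_le_sub_left (ciInf_le P.bddBelow _) _

theorem sum_meanSq_descent_le [IsProbabilityMeasure μ] (hη : 0 ≤ P.η) (hηL : P.η * P.L ≤ 1 / 4)
    (T : ℕ) :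
    P.η / 2 * ∑ t ∈ Finset.range T, meanSq μ (P.grad t) +
      3 * P.η / 8 * ∑ t ∈ Finset.range T, meanSq μ (P.m (t + 1)) ≤
      P.f P.x₀ - (⨅ x, P.f x) + P.η / 2 * (∑ t ∈ Finset.range T, meanSq μ (P.momentumError t) +
        ∑ t ∈ Finset.range T, meanSq μ (P.projectionError t)) := by
  have hgrad := fun t => (integrable_norm_sq (P.memL2_grad t).memLp).const_mul (P.η / 2)
  have hm := fun t => (integrable_norm_sq (P.memL2_m (t + 1)).memLp).const_mul (3 * P.η / 8)
  have hmom := fun t => integrable_norm_sq (P.memL2_momentumError t).memLp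
  have hproj := fun t => integrable_norm_sq (P.memL2_projectionError t).memLp
  have hmain : ∀ t, Integrable (fun ω =>
      P.η / 2 * ‖P.grad t ω‖ ^ 2 + 3 * P.η / 8 * ‖P.m (t + 1) ω‖ ^ 2) μ := fun t =>
    (hgrad t).add (hm t)
  have herr : ∀ t, Integrable (fun ω =>
      P.η / 2 * (‖P.momentumError t ω‖ ^ 2 + ‖P.projectionError t ω‖ ^ 2)) μ := fun t =>
    ((hmom t).add (hproj t)).const_mul _
  have integrated := integral_mono
    (integrable_finsetSum (Finset.range T) fun t _ => (hmain t).sub (herr t))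
    (integrable_const (P.f P.x₀ - ⨅ x, P.f x)) (P.sum_descent_le_gap hη hηL T)
  rw [integral_finsetSum _ fun t _ => (hmain t).sub (herr t), integral_const, probReal_univ,
    one_smul] at integrated
  have split : ∀ t, ∫ ω, (P.η / 2 * ‖P.grad t ω‖ ^ 2 + 3 * P.η / 8 * ‖P.m (t + 1) ω‖ ^ 2 -
      P.η / 2 * (‖P.momentumError t ω‖ ^ 2 + ‖P.projectionError t ω‖ ^ 2)) ∂μ =
      P.η / 2 * meanSq μ (P.grad t) + 3 * P.η / 8 * meanSq μ (P.m (t + 1)) -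
      P.η / 2 * (meanSq μ (P.momentumError t) + meanSq μ (P.projectionError t)) := fun t => by
    rw [integral_sub (hmain t) (herr t), integral_add (hgrad t) (hm t), integral_const_mul,
      integral_const_mul, integral_const_mul, integral_add (hmom t) (hproj t)]
    rfl
  simp only [Pi.sub_apply, split, Finset.sum_sub_distrib, Finset.sum_add_distrib,
    ← Finset.mul_sum] at integrated
  linarith

end Descent

section MomentumError

variable [IsFiniteMeasure μ]

omit [IsFiniteMeasure μ] in
theorem meanSq_momentumError_le_of_eq {t : ℕ} {Y : Ω → E} (hY : MemL2 (P.ℱ t) μ Y)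
    (h : ∀ ω, P.momentumError t ω = P.p (t + 1) ω ((1 - P.β) • Y ω + P.β • P.noise t ω)) :
    meanSq μ (P.momentumError t) ≤ (1 - P.β) ^ 2 * meanSq μ Y + P.β ^ 2 * P.s := by
  have hY' := hY.const_smul (1 - P.β)
  have hnoise := ((P.memL2_noise t).const_smul P.β).memLp
  have uncorrelated : ∫ ω, inner ℝ (((1 - P.β) • Y) ω) ((P.β • P.noise t) ω) ∂μ = 0 := by
    simp_rw [Pi.smul_apply P.β, inner_smul_right, integral_const_mul,
      P.integral_inner_noise t _ hY', mul_zero]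
  calc meanSq μ (P.momentumError t) ≤ meanSq μ ((1 - P.β) • Y + P.β • P.noise t) :=
        meanSq_mono (hY'.memLp.add hnoise) fun ω => by
          rw [h]
          exact norm_apply_le_of_isSymmetricProjection (P.isSymmetricProjection _ _) _
    _ = (1 - P.β) ^ 2 * meanSq μ Y + P.β ^ 2 * meanSq μ (P.noise t) := by
        rw [meanSq_add_of_integral_inner_eq_zero hY'.memLp hnoise uncorrelated, meanSq_const_smul,
          meanSq_const_smul]
    _ ≤ _ := by gcongr; exact P.meanSq_noise_le t

theorem meanSq_momentumError_le {t : ℕ} (ht : t % P.τ ≠ 0) :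
    meanSq μ (P.momentumError t) ≤
      (1 - P.β) ^ 2 * meanSq μ (P.laggedError t) + P.β ^ 2 * P.s := by
  refine P.meanSq_momentumError_le_of_eq (P.memL2_laggedError t) fun ω => ?_
  simp only [momentumError, laggedError, grad, P.m_succ, P.p_succ t ω ht, map_add, map_sub,
    map_smul, P.apply_m, apply_apply_of_isSymmetricProjection (P.isSymmetricProjection t ω)]
  module

theorem meanSq_momentumError_le_of_switch (t : ℕ) :
    meanSq μ (P.momentumError t) ≤ (1 - P.β) ^ 2 * meanSq μ (P.laggedError t) +
      meanSq μ (P.grad t) + P.β ^ 2 * P.s := by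
  have stale : meanSq μ (P.m t - P.grad t) ≤
      1 * meanSq μ (P.laggedError t) + 1 * meanSq μ (P.grad t) :=
    meanSq_le_of_norm_sq_le_add (P.memL2_laggedError t).memLp (P.memL2_grad t).memLp fun ω => by
      rw [Pi.sub_apply, norm_sub_rev, norm_sub_sq_of_apply_eq_self (P.isSymmetricProjection t ω)
        (P.apply_m t ω), one_mul, one_mul, laggedError]
      gcongr
      exact norm_sub_apply_le_of_isSymmetricProjection (P.isSymmetricProjection t ω) _
  have sq_le_one : (1 - P.β) ^ 2 ≤ 1 :=
    pow_le_one₀ (sub_nonneg.2 P.β_le_one) (sub_le_self _ P.β_pos.le)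
  calc meanSq μ (P.momentumError t)
      ≤ (1 - P.β) ^ 2 * meanSq μ (P.m t - P.grad t) + P.β ^ 2 * P.s := by
        refine P.meanSq_momentumError_le_of_eq ((P.memL2_m t).sub (P.memL2_grad t)) fun ω => ?_
        rw [momentumError, P.m_succ, ← map_sub]
        congr 1
        simp only [grad, Pi.sub_apply]
        module
    _ ≤ (1 - P.β) ^ 2 * (1 * meanSq μ (P.laggedError t) + 1 * meanSq μ (P.grad t)) +
        P.β ^ 2 * P.s := by gcongr
    _ ≤ _ := by nlinarith [mul_le_mul_of_nonneg_right sq_le_one (meanSq_nonneg (μ := μ) (P.grad t))]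

theorem meanSq_grad_sub_le (i j : ℕ) :
    meanSq μ (P.grad i - P.grad j) ≤ P.L ^ 2 * meanSq μ (P.X i - P.X j) :=
  meanSq_le_of_norm_le_mul ((P.memL2_X_and_m i).1.memLp.sub (P.memL2_X_and_m j).1.memLp) fun _ =>
    P.lipschitz.norm_sub_le _ _

omit [IsFiniteMeasure μ] in
theorem meanSq_X_succ_sub (t : ℕ) :
    meanSq μ (P.X (t + 1) - P.X t) = P.η ^ 2 * meanSq μ (P.m (t + 1)) := by
  have hmove : P.X (t + 1) - P.X t = (-P.η) • P.m (t + 1) := by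
    ext ω
    simp [P.X_succ]
  rw [hmove, meanSq_const_smul, neg_sq]

omit [IsFiniteMeasure μ] in
theorem laggedError_zero : P.laggedError 0 = 0 := by
  ext ω
  simp [laggedError, P.m_zero, P.p_zero]

theorem meanSq_laggedError_succ_le (t : ℕ) :
    (1 - P.β) ^ 2 * meanSq μ (P.laggedError (t + 1)) ≤
      (1 - P.β) * meanSq μ (P.momentumError t) +
        (P.η * P.L) ^ 2 / P.β * meanSq μ (P.m (t + 1)) := by
  have hβ := P.β_pos
  have hβ' : 0 ≤ 1 - P.β := sub_nonneg.2 P.β_le_one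
  have young : meanSq μ (P.laggedError (t + 1)) ≤ (1 + P.β) * meanSq μ (P.momentumError t) +
      (1 + 1 / P.β) * meanSq μ (P.grad (t + 1) - P.grad t) := by
    refine meanSq_le_of_norm_sq_le_add (P.memL2_momentumError t).memLp
      ((P.memL2_grad (t + 1)).memLp.sub (P.memL2_grad t).memLp) fun ω => ?_
    calc ‖P.laggedError (t + 1) ω‖ ^ 2
        = ‖P.momentumError t ω + P.p (t + 1) ω (P.grad t ω - P.grad (t + 1) ω)‖ ^ 2 := by
          rw [laggedError, momentumError, map_sub]; congr 2; abel
      _ ≤ _ := norm_add_sq_le_weighted hβ _ _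
      _ ≤ _ := by
          gcongr
          rw [Pi.sub_apply, norm_sub_rev]
          exact norm_apply_le_of_isSymmetricProjection (P.isSymmetricProjection _ _) _
  have drift : meanSq μ (P.grad (t + 1) - P.grad t) ≤
      (P.η * P.L) ^ 2 * meanSq μ (P.m (t + 1)) := by
    refine (P.meanSq_grad_sub_le _ _).trans_eq ?_
    rw [meanSq_X_succ_sub]; ring
  have coeff_mom : (1 - P.β) ^ 2 * (1 + P.β) ≤ 1 - P.β := by
    nlinarith [mul_nonneg hβ' (sq_nonneg P.β)]
  have coeff_drift : (1 - P.β) ^ 2 * (1 + 1 / P.β) ≤ 1 / P.β := by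
    rw [one_add_div hβ.ne', ← mul_div_assoc]
    gcongr
    rw [add_comm]
    exact coeff_mom.trans (sub_le_self _ hβ.le)
  calc (1 - P.β) ^ 2 * meanSq μ (P.laggedError (t + 1))
      ≤ (1 - P.β) ^ 2 * ((1 + P.β) * meanSq μ (P.momentumError t) +
        (1 + 1 / P.β) * ((P.η * P.L) ^ 2 * meanSq μ (P.m (t + 1)))) := by
        gcongr; exact young.trans (by gcongr)
    _ = (1 - P.β) ^ 2 * (1 + P.β) * meanSq μ (P.momentumError t) +
        (1 - P.β) ^ 2 * (1 + 1 / P.β) * ((P.η * P.L) ^ 2 * meanSq μ (P.m (t + 1))) := by ring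
    _ ≤ (1 - P.β) * meanSq μ (P.momentumError t) +
        1 / P.β * ((P.η * P.L) ^ 2 * meanSq μ (P.m (t + 1))) := by
        have := meanSq_nonneg (μ := μ) (P.momentumError t)
        have := meanSq_nonneg (μ := μ) (P.m (t + 1))
        gcongr
    _ = _ := by ring

theorem sum_meanSq_momentumError_le (T : ℕ) :
    P.β * ∑ t ∈ Finset.range T, meanSq μ (P.momentumError t) ≤
      (P.η * P.L) ^ 2 / P.β * ∑ t ∈ Finset.range T, meanSq μ (P.m (t + 1)) +
        ∑ t ∈ Finset.range T, (if t % P.τ = 0 then meanSq μ (P.grad t) else 0) +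
        T * (P.β ^ 2 * P.s) := by
  have step : ∀ t, meanSq μ (P.momentumError t) ≤ (1 - P.β) ^ 2 * meanSq μ (P.laggedError t) +
      (if t % P.τ = 0 then meanSq μ (P.grad t) else 0) + P.β ^ 2 * P.s := fun t => by
    split_ifs with ht
    · exact P.meanSq_momentumError_le_of_switch t
    · rw [add_zero]; exact P.meanSq_momentumError_le ht
  have telescoped : P.β * ∑ t ∈ Finset.range T, meanSq μ (P.momentumError t) +
      (1 - P.β) ^ 2 * meanSq μ (P.laggedError T) ≤
      (P.η * P.L) ^ 2 / P.β * ∑ t ∈ Finset.range T, meanSq μ (P.m (t + 1)) +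
        ∑ t ∈ Finset.range T, (if t % P.τ = 0 then meanSq μ (P.grad t) else 0) +
        T * (P.β ^ 2 * P.s) := by
    induction T with
    | zero => simp [P.laggedError_zero, meanSq]
    | succ t ih =>
      simp only [Finset.sum_range_succ, Nat.cast_succ]
      linarith [step t, P.meanSq_laggedError_succ_le t]
  exact (le_add_of_nonneg_right (mul_nonneg (sq_nonneg _) (meanSq_nonneg _))).trans telescoped

end MomentumError

section Period

variable [IsFiniteMeasure μ] {t r : ℕ}

omit [IsFiniteMeasure μ] in
theorem p_add (ht : t % P.τ = 0) (hr : r < P.τ) (ω : Ω) : P.p (t + r + 1) ω = P.p (t + 1) ω := by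
  induction r with
  | zero => rfl
  | succ r ih =>
    have off_switch : (t + (r + 1)) % P.τ ≠ 0 := by
      rw [Nat.add_mod, ht, zero_add, Nat.mod_mod, Nat.mod_eq_of_lt hr]
      exact r.succ_ne_zero
    rw [P.p_succ _ ω off_switch, ← add_assoc, ih (by lia)]

theorem meanSq_grad_add_sub_le (t : ℕ) (hr : r ≤ P.τ) :
    meanSq μ (P.grad (t + r) - P.grad t) ≤
      (P.η * P.L) ^ 2 * (P.τ * ∑ i ∈ Finset.range P.τ, meanSq μ (P.m (t + i + 1))) := by
  have telescope : P.X (t + r) - P.X t = ∑ i ∈ Finset.range r, (-P.η) • P.m (t + i + 1) := by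
    refine .trans (Finset.sum_range_sub (fun i => P.X (t + i)) r).symm ?_
    refine Finset.sum_congr rfl fun i _ => ?_
    ext ω
    simp [← add_assoc, P.X_succ]
  calc meanSq μ (P.grad (t + r) - P.grad t)
      ≤ P.L ^ 2 * meanSq μ (∑ i ∈ Finset.range r, (-P.η) • P.m (t + i + 1)) := by
        rw [← telescope]; exact P.meanSq_grad_sub_le _ _
    _ ≤ P.L ^ 2 * (P.τ * ∑ i ∈ Finset.range P.τ, meanSq μ ((-P.η) • P.m (t + i + 1))) := by
        gcongr
        exact meanSq_sum_range_le hr fun i => (P.memL2_m (t + i + 1)).memLp.const_smul _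
    _ = _ := by simp only [meanSq_const_smul, ← Finset.mul_sum]; ring

theorem meanSq_grad_le_add_drift (t : ℕ) (hr : r ≤ P.τ) :
    meanSq μ (P.grad t) ≤ 2 * meanSq μ (P.grad (t + r)) +
      2 * ((P.η * P.L) ^ 2 * (P.τ * ∑ i ∈ Finset.range P.τ, meanSq μ (P.m (t + i + 1)))) := by
  have hsub := meanSq_add_le_two (μ := μ) (P.memL2_grad (t + r)).memLp
    ((P.memL2_grad t).memLp.sub (P.memL2_grad (t + r)).memLp)
  rw [add_sub_cancel] at hsub
  refine hsub.trans ?_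
  gcongr
  refine le_trans (le_of_eq ?_) (P.meanSq_grad_add_sub_le t hr)
  rw [← neg_sub, ← neg_one_smul ℝ, meanSq_const_smul]
  norm_num

theorem meanSq_projectionError_add_le (ht : t % P.τ = 0) (hr : r < P.τ) :
    meanSq μ (P.projectionError (t + r)) ≤ (1 - P.δ / 2) * meanSq μ (P.grad (t + r)) +
      16 / P.δ * ((P.η * P.L) ^ 2 *
        (P.τ * ∑ i ∈ Finset.range P.τ, meanSq μ (P.m (t + i + 1))) + P.N) := by
  have hdrift := (P.memL2_grad (t + r)).memLp.sub (P.memL2_grad t).memLp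
  have hnoise := (P.memL2_noise t).memLp
  have hδ := P.δ_pos
  have captured : meanSq μ (P.projectionError (t + r)) ≤ (1 - P.δ / 2) * meanSq μ (P.grad (t + r)) +
      8 / P.δ * meanSq μ (P.grad (t + r) - P.grad t + (-1 : ℝ) • P.noise t) := by
    refine meanSq_le_of_norm_sq_le_add (P.memL2_grad (t + r)).memLp
      (hdrift.add (hnoise.const_smul _)) fun ω => ?_
    rw [projectionError, P.p_add ht hr]
    convert norm_sub_apply_sq_le_of_capture (P.isSymmetricProjection (t + 1) ω) hδ P.δ_le_one
      (P.capture t ω ht) (P.grad (t + r) ω) using 5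
    simp only [Pi.add_apply, Pi.sub_apply, Pi.smul_apply, grad]
    module
  have split : meanSq μ (P.grad (t + r) - P.grad t + (-1 : ℝ) • P.noise t) ≤
      2 * ((P.η * P.L) ^ 2 * (P.τ * ∑ i ∈ Finset.range P.τ, meanSq μ (P.m (t + i + 1)))) +
        2 * P.N := by
    refine (meanSq_add_le_two hdrift (hnoise.const_smul _)).trans ?_
    rw [meanSq_const_smul, neg_one_sq, one_mul]
    gcongr
    exacts [P.meanSq_grad_add_sub_le t hr.le, P.meanSq_noise_le_of_switch t ht]
  linear_combination captured + 8 / P.δ * split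

end Period

section Sum

variable (K : ℕ)

theorem sum_meanSq_projectionError_le [IsFiniteMeasure μ] :
    ∑ t ∈ Finset.range (K * P.τ), meanSq μ (P.projectionError t) ≤
      (1 - P.δ / 2) * ∑ t ∈ Finset.range (K * P.τ), meanSq μ (P.grad t) +
        16 / P.δ * ((P.η * P.L * P.τ) ^ 2 *
          ∑ t ∈ Finset.range (K * P.τ), meanSq μ (P.m (t + 1)) + P.N * (K * P.τ)) := by
  simp only [sum_range_mul]
  refine (Finset.sum_le_sum fun k _ => Finset.sum_le_sum fun r hr =>
    P.meanSq_projectionError_add_le (Nat.mul_mod_left k P.τ) (Finset.mem_range.1 hr)).trans_eq ?_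
  simp only [Finset.sum_add_distrib, Finset.sum_const, Finset.card_range, ← Finset.mul_sum,
    nsmul_eq_mul]
  ring

theorem mul_sum_meanSq_grad_switch_le [IsFiniteMeasure μ] :
    P.τ * ∑ k ∈ Finset.range K, meanSq μ (P.grad (k * P.τ)) ≤
      2 * ∑ t ∈ Finset.range (K * P.τ), meanSq μ (P.grad t) +
        2 * (P.η * P.L * P.τ) ^ 2 *
          ∑ t ∈ Finset.range (K * P.τ), meanSq μ (P.m (t + 1)) := by
  have over_period := Finset.sum_le_sum fun k (_ : k ∈ Finset.range K) =>
    Finset.sum_le_sum fun r (hr : r ∈ Finset.range P.τ) =>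
      P.meanSq_grad_le_add_drift (μ := μ) (k * P.τ) (Finset.mem_range.1 hr).le
  simp only [sum_range_mul]
  simp only [Finset.sum_add_distrib, Finset.sum_const, Finset.card_range, ← Finset.mul_sum,
    nsmul_eq_mul] at over_period
  linarith

theorem mul_L_mul_τ_le (hηLτ : (P.η * P.L * P.τ) ^ 2 ≤ P.δ / 40) :
    P.η * P.L * P.τ ≤ 1 / 4 := by
  have hsq : (P.η * P.L * P.τ) ^ 2 ≤ (1 / 4) ^ 2 := by linarith [P.δ_le_one]
  exact le_of_sq_le_sq hsq (by norm_num)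

-- Switches are so rare, `64 / (3 β δ) ≤ τ`, that the `‖∇f‖²` which each of them costs is paid for
-- by the fraction `δ` that the projections capture.
theorem sum_meanSq_momentumError_le_of_le_τ [IsFiniteMeasure μ] (hη : 0 ≤ P.η)
    (hτ : 64 / (3 * P.β * P.δ) ≤ P.τ) (hηLτ : (P.η * P.L * P.τ) ^ 2 ≤ P.δ / 40) :
    ∑ t ∈ Finset.range (K * P.τ), meanSq μ (P.momentumError t) ≤
      3 * P.δ / 32 * ∑ t ∈ Finset.range (K * P.τ), meanSq μ (P.grad t) +
        1 / 4 * ∑ t ∈ Finset.range (K * P.τ), meanSq μ (P.m (t + 1)) +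
          P.β * P.s * (K * P.τ) := by
  have hβ := P.β_pos
  have hδ := P.δ_pos
  have hδ1 := P.δ_le_one
  have hτ0 : (0 : ℝ) < P.τ := (by positivity : 0 < 64 / (3 * P.β * P.δ)).trans_le hτ
  have hβδτ : 64 ≤ 3 * P.β * P.δ * P.τ := (div_le_iff₀' (by positivity)).1 hτ
  have hκβ : P.η * P.L ≤ P.β / 84 := by
    refine le_of_mul_le_mul_right (?_ : _ ≤ P.β / 84 * P.τ) hτ0
    linarith [P.mul_L_mul_τ_le hηLτ, mul_le_of_le_one_right (mul_pos hβ hτ0).le hδ1]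
  have hmom := P.sum_meanSq_momentumError_le (μ := μ) (K * P.τ)
  have hswitch := P.mul_sum_meanSq_grad_switch_le (μ := μ) K
  rw [sum_range_mul_ite_mod_eq_zero _ _ (by exact_mod_cast hτ0), Nat.cast_mul] at hmom
  set G := ∑ t ∈ Finset.range (K * P.τ), meanSq μ (P.grad t)
  set M := ∑ t ∈ Finset.range (K * P.τ), meanSq μ (P.m (t + 1))
  set S := ∑ k ∈ Finset.range K, meanSq μ (P.grad (k * P.τ))
  have hM : 0 ≤ M := Finset.sum_nonneg fun _ _ => meanSq_nonneg _
  have hS : 0 ≤ S := Finset.sum_nonneg fun _ _ => meanSq_nonneg _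
  have drift_coeff : (P.η * P.L) ^ 2 / P.β * M ≤ P.β / 8 * M := by
    refine mul_le_mul_of_nonneg_right ((div_le_iff₀ hβ).2 ?_) hM
    nlinarith [pow_le_pow_left₀ (mul_nonneg hη P.L.coe_nonneg) hκβ 2, sq_nonneg P.β]
  have switch_cost : S ≤ P.β * (3 * P.δ / 32 * G + 1 / 8 * M) := by
    have hτS : P.τ * S ≤ 2 * G + 2 * (P.δ / 40) * M := hswitch.trans (by gcongr)
    have hscaled := mul_le_mul_of_nonneg_left hτS (by positivity : 0 ≤ 3 * P.β * P.δ / 64)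
    have hδM : P.β * (P.δ ^ 2 * M) ≤ P.β * (1 * M) := by gcongr; exact pow_le_one₀ hδ.le hδ1
    nlinarith [mul_le_mul_of_nonneg_right hβδτ hS, mul_nonneg hβ.le hM]
  refine le_of_mul_le_mul_left ?_ hβ
  linarith

theorem sum_meanSq_grad_le [IsProbabilityMeasure μ] (hη : 0 ≤ P.η)
    (hτ : 64 / (3 * P.β * P.δ) ≤ P.τ) (hηLτ : (P.η * P.L * P.τ) ^ 2 ≤ P.δ / 40) :
    P.η * P.δ / 8 * ∑ t ∈ Finset.range (K * P.τ), meanSq μ (P.grad t) ≤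
      P.f P.x₀ - (⨅ x, P.f x) + P.η / 2 * ((16 / P.δ * P.N + P.β * P.s) * (K * P.τ)) := by
  have hδ := P.δ_pos
  have hηL : P.η * P.L ≤ 1 / 4 := by
    have hτ1 : (1 : ℝ) ≤ P.τ := by
      refine le_trans ?_ hτ
      rw [one_le_div (by have := P.β_pos; positivity)]
      linarith [mul_le_one₀ P.β_le_one hδ.le P.δ_le_one]
    exact (le_mul_of_one_le_right (mul_nonneg hη P.L.coe_nonneg) hτ1).trans (P.mul_L_mul_τ_le hηLτ)
  have descent := P.sum_meanSq_descent_le hη hηL (K * P.τ)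
  have hmom := P.sum_meanSq_momentumError_le_of_le_τ K hη hτ hηLτ
  have hproj := P.sum_meanSq_projectionError_le (μ := μ) K
  set G := ∑ t ∈ Finset.range (K * P.τ), meanSq μ (P.grad t)
  set M := ∑ t ∈ Finset.range (K * P.τ), meanSq μ (P.m (t + 1))
  have hG : 0 ≤ G := Finset.sum_nonneg fun _ _ => meanSq_nonneg _
  have hM : 0 ≤ M := Finset.sum_nonneg fun _ _ => meanSq_nonneg _
  have drift_coeff : 16 / P.δ * ((P.η * P.L * P.τ) ^ 2 * M) ≤ 2 / 5 * M := by
    calc _ ≤ 16 / P.δ * (P.δ / 40 * M) := by gcongr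
      _ = 2 / 5 * M := by field_simp; ring
  linear_combination descent + P.η / 2 * (hmom + hproj + drift_coeff) +
    P.η * (5 * P.δ / 64 * hG + 1 / 20 * hM)

end Sum

end ProjectedMomentum

/-! ### Truncated singular value decompositions -/

section SVD

open Matrix

variable {m n r : ℕ}

theorem frobSq_nonneg (G : Matrix (Fin m) (Fin n) ℝ) : 0 ≤ frobSq G :=
  Finset.sum_nonneg fun _ _ => Finset.sum_nonneg fun _ _ => sq_nonneg _

theorem frobSq_eq_trace (G : Matrix (Fin m) (Fin n) ℝ) : frobSq G = (Gᵀ * G).trace := by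
  simp only [frobSq, Matrix.trace, Matrix.diag, Matrix.mul_apply, Matrix.transpose_apply, ← sq]
  exact Finset.sum_comm

theorem frobSq_transpose (G : Matrix (Fin m) (Fin n) ℝ) : frobSq Gᵀ = frobSq G :=
  Finset.sum_comm

theorem frobSq_mul_mul_transpose {U : Matrix (Fin m) (Fin m) ℝ} {V : Matrix (Fin n) (Fin n) ℝ}
    (hU : Uᵀ * U = 1) (hV : Vᵀ * V = 1) (A : Matrix (Fin m) (Fin n) ℝ) :
    frobSq (U * A * Vᵀ) = frobSq A := by
  calc frobSq (U * A * Vᵀ) = (V * (Aᵀ * (Uᵀ * U) * A) * Vᵀ).trace := by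
        simp only [frobSq_eq_trace, transpose_mul, transpose_transpose, Matrix.mul_assoc]
    _ = (Vᵀ * V * (Aᵀ * A)).trace := by
        rw [hU, Matrix.trace_mul_comm, Matrix.mul_one, Matrix.mul_assoc]
    _ = frobSq A := by rw [hV, Matrix.one_mul, frobSq_eq_trace]

-- Chebyshev's sum inequality for `a` against the indicator of `{i | r ≤ i}`.
theorem sum_tail_le_of_antitone (hr : r ≤ m) {a : Fin m → ℝ} (ha : Antitone a) :
    ∑ i : Fin m, (if (i : ℕ) < r then 0 else a i) ≤ (1 - (r : ℝ) / m) * ∑ i, a i := by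
  obtain rfl | hm := m.eq_zero_or_pos
  · simp
  have antivary : Antivary a fun i : Fin m => if (i : ℕ) < r then (0 : ℝ) else 1 := by
    refine ha.antivary fun i j hij => ?_
    have : (i : ℕ) ≤ j := hij
    split_ifs <;> first | omega | norm_num
  have card_tail : ∑ i : Fin m, (if (i : ℕ) < r then (0 : ℝ) else 1) = m - r := by
    have head_tail := Finset.card_filter_add_card_filter_not (s := Finset.univ)
      fun i : Fin m => (i : ℕ) < r
    rw [Fin.card_filter_val_lt, min_eq_right hr, Finset.card_univ, Fintype.card_fin] at head_tail
    rw [Finset.sum_ite, Finset.sum_const_zero, zero_add, Finset.sum_const, nsmul_one,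
      eq_sub_iff_add_eq']
    exact_mod_cast head_tail
  have chebyshev := antivary.card_mul_sum_le_sum_mul_sum
  simp only [card_tail, Fintype.card_fin, mul_ite, mul_zero, mul_one] at chebyshev
  have hm' : (0 : ℝ) < m := by exact_mod_cast hm
  rw [one_sub_div hm'.ne', div_mul_eq_mul_div, le_div_iff₀ hm', mul_comm, mul_comm ((m : ℝ) - r)]
  exact chebyshev

theorem firstCols_mul_transpose (h : r ≤ m) (U : Matrix (Fin m) (Fin m) ℝ) :
    firstCols h U * (firstCols h U)ᵀ =
      U * diagonal (fun i : Fin m => if (i : ℕ) < r then (1 : ℝ) else 0) * Uᵀ := by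
  ext i j
  rw [Matrix.mul_apply, Matrix.mul_apply]
  simp only [mul_diagonal, transpose_apply, firstCols, submatrix_apply, id]
  calc ∑ k : Fin r, U i (Fin.castLE h k) * U j (Fin.castLE h k)
      = ∑ k ∈ Finset.univ.map (Fin.castLEEmb h), U i k * U j k := by simp
    _ = ∑ k, U i k * (if (k : ℕ) < r then 1 else 0) * U j k := by
        refine Finset.sum_subset_zero_on_sdiff (Finset.subset_univ _) (fun k hk => ?_)
          fun k hk => ?_
        · have : ¬ (k : ℕ) < r := fun hkr => (Finset.mem_sdiff.1 hk).2
            (Finset.mem_map.2 ⟨⟨k, hkr⟩, Finset.mem_univ _, Fin.ext rfl⟩)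
          simp [this]
        · obtain ⟨k, -, rfl⟩ := Finset.mem_map.1 hk
          simp

theorem transpose_firstCols_mul (h : r ≤ m) {U : Matrix (Fin m) (Fin m) ℝ} (hU : Uᵀ * U = 1) :
    (firstCols h U)ᵀ * firstCols h U = 1 := by
  ext i j
  have orthonormal := congr_fun₂ hU (Fin.castLE h i) (Fin.castLE h j)
  simp only [Matrix.mul_apply, transpose_apply, firstCols, submatrix_apply, id]
    at orthonormal ⊢
  rw [orthonormal, Matrix.one_apply, Matrix.one_apply]
  simp [Fin.ext_iff]

namespace IsSVD

variable {G : Matrix (Fin m) (Fin n) ℝ} {s : SVDFactors m n}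

theorem transpose_mul_U (h : IsSVD G s) : s.Uᵀ * s.U = 1 :=
  (Matrix.mem_orthogonalGroup_iff' (Fin m) ℝ).1 h.orthogonal_U

theorem transpose_mul_V (h : IsSVD G s) : s.Vᵀ * s.V = 1 :=
  (Matrix.mem_orthogonalGroup_iff' (Fin n) ℝ).1 h.orthogonal_V

theorem transpose (h : IsSVD G s) : IsSVD Gᵀ ⟨s.V, s.Sᵀ, s.U⟩ where
  orthogonal_U := h.orthogonal_V
  orthogonal_V := h.orthogonal_U
  eq_mul := by
    rw [h.eq_mul, transpose_mul, transpose_mul, transpose_transpose, Matrix.mul_assoc]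
  diag i j hij := h.diag j i (Ne.symm hij)
  nonneg i j := h.nonneg j i
  antitone i i' j j' hij hij' hi := h.antitone j j' i i' hij.symm hij'.symm (by
    rw [Fin.le_def] at hi ⊢; omega)

theorem antitone_sum_sq (h : IsSVD G s) (hmn : m ≤ n) : Antitone fun i => ∑ j, s.S i j ^ 2 := by
  have sum_eq : ∀ i, ∑ j, s.S i j ^ 2 = s.S i (Fin.castLE hmn i) ^ 2 := fun i =>
    Finset.sum_eq_single _ (fun j _ hj => by
      rw [h.diag i j fun hij => hj (Fin.ext (by simpa using hij.symm)), sq, zero_mul]) (by simp)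
  intro i i' hi
  simp only [sum_eq]
  exact pow_le_pow_left₀ (h.nonneg _ _) (h.antitone i i' _ _ (by simp) (by simp) hi) 2

theorem frobSq_sub_firstCols_mul_le (h : IsSVD G s) (hmn : m ≤ n) (hr : r ≤ m) :
    frobSq (G - firstCols hr s.U * (firstCols hr s.U)ᵀ * G) ≤ (1 - (r : ℝ) / m) * frobSq G := by
  set I : Matrix (Fin m) (Fin m) ℝ := diagonal fun i => if (i : ℕ) < r then 1 else 0 with hI
  have projection : firstCols hr s.U * (firstCols hr s.U)ᵀ * G = s.U * (I * s.S) * s.Vᵀ := by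
    calc firstCols hr s.U * (firstCols hr s.U)ᵀ * G
        = s.U * I * s.Uᵀ * (s.U * s.S * s.Vᵀ) := by rw [firstCols_mul_transpose, ← h.eq_mul]
      _ = s.U * I * (s.Uᵀ * s.U) * s.S * s.Vᵀ := by simp only [Matrix.mul_assoc]
      _ = s.U * (I * s.S) * s.Vᵀ := by
        rw [h.transpose_mul_U, Matrix.mul_one, Matrix.mul_assoc s.U]
  have residual : frobSq (G - firstCols hr s.U * (firstCols hr s.U)ᵀ * G) =
      frobSq (s.S - I * s.S) := by
    rw [projection, ← frobSq_mul_mul_transpose h.transpose_mul_U h.transpose_mul_V (s.S - _),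
      Matrix.mul_sub, Matrix.sub_mul, ← h.eq_mul]
  have total : frobSq G = ∑ i, ∑ j, s.S i j ^ 2 := by
    rw [h.eq_mul, frobSq_mul_mul_transpose h.transpose_mul_U h.transpose_mul_V]; rfl
  rw [residual, total]
  refine le_of_eq_of_le (Finset.sum_congr rfl fun i _ => ?_)
    (sum_tail_le_of_antitone hr (h.antitone_sum_sq hmn))
  simp only [hI, Matrix.sub_apply, diagonal_mul]
  split_ifs <;> simp

end IsSVD

end SVD

/-! ### The projection of one layer -/

section LayerMem

open Matrix

variable {m n r : ℕ}

namespace LayerMem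

/-- The projection `G ↦ P Pᵀ G` (`m ≤ n`) or `G ↦ G Q Qᵀ` (`m > n`) of layer gradients onto the
subspace held in memory. -/
noncomputable def proj (c : LayerMem m n r) :
    Matrix (Fin m) (Fin n) ℝ →ₗ[ℝ] Matrix (Fin m) (Fin n) ℝ :=
  if m ≤ n then mulLeftLinearMap _ ℝ (c.P * c.Pᵀ) else mulRightLinearMap _ ℝ (c.Q * c.Qᵀ)

/-- The projection matrices are partial isometries; besides orthonormal columns this allows the
zero matrices of the initial state. -/
structure IsPartialIsometry (c : LayerMem m n r) : Prop where
  left : c.P * c.Pᵀ * c.P = c.P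
  right : c.Q * c.Qᵀ * c.Q = c.Q

variable {c : LayerMem m n r}

theorem proj_of_le (hmn : m ≤ n) (G : Matrix (Fin m) (Fin n) ℝ) :
    c.proj G = c.P * c.Pᵀ * G := by
  rw [proj, if_pos hmn, mulLeftLinearMap_apply]

theorem proj_of_not_le (hmn : ¬m ≤ n) (G : Matrix (Fin m) (Fin n) ℝ) :
    c.proj G = G * (c.Q * c.Qᵀ) := by
  rw [proj, if_neg hmn, mulRightLinearMap_apply]

theorem IsPartialIsometry.proj_proj (hc : c.IsPartialIsometry) (G : Matrix (Fin m) (Fin n) ℝ) :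
    c.proj (c.proj G) = c.proj G := by
  by_cases hmn : m ≤ n
  · rw [proj_of_le hmn, proj_of_le hmn, ← Matrix.mul_assoc, ← Matrix.mul_assoc, hc.left]
  · rw [proj_of_not_le hmn, proj_of_not_le hmn, Matrix.mul_assoc, ← Matrix.mul_assoc _ c.Q,
      hc.right]

theorem trace_transpose_proj_mul (G G' : Matrix (Fin m) (Fin n) ℝ) :
    ((c.proj G)ᵀ * G').trace = (Gᵀ * c.proj G').trace := by
  by_cases hmn : m ≤ n
  · simp only [proj_of_le hmn, transpose_mul, transpose_transpose, Matrix.mul_assoc]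
  · simp only [proj_of_not_le hmn, transpose_mul, transpose_transpose]
    rw [Matrix.mul_assoc, Matrix.trace_mul_comm, Matrix.mul_assoc]

end LayerMem

variable (h : r ≤ min m n) (H : Hyper) (t : ℕ) {G : Matrix (Fin m) (Fin n) ℝ}
  {s : SVDFactors m n} {c : LayerMem m n r}

theorem updateMem_isPartialIsometry (hs : IsSVD G s) (hc : c.IsPartialIsometry) :
    (updateMem h H t G s c).IsPartialIsometry := by
  unfold updateMem
  split_ifs
  · refine ⟨?_, hc.right⟩
    rw [Matrix.mul_assoc, transpose_firstCols_mul _ hs.transpose_mul_U, Matrix.mul_one]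
  · refine ⟨hc.left, ?_⟩
    rw [Matrix.mul_assoc, transpose_firstCols_mul _ hs.transpose_mul_V, Matrix.mul_one]
  · exact ⟨hc.left, hc.right⟩
  · exact ⟨hc.left, hc.right⟩

theorem direction_updateMem (hc : c.IsPartialIsometry) :
    (updateMem h H t G s c).direction =
      (updateMem h H t G s c).proj ((1 - H.β) • c.direction + H.β • G) := by
  by_cases hmn : m ≤ n
  · have hP : ∀ M : Matrix (Fin r) (Fin n) ℝ, c.P * (c.Pᵀ * (c.P * M)) = c.P * M := fun M => by
      rw [← Matrix.mul_assoc, ← Matrix.mul_assoc, hc.left]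
    simp only [LayerMem.proj_of_le hmn, LayerMem.direction, updateMem, if_pos hmn]
    split_ifs <;> simp only [Matrix.mul_add, Matrix.mul_smul, Matrix.mul_assoc, hP]
  · have hQ : c.Qᵀ * (c.Q * c.Qᵀ) = c.Qᵀ := by
      simpa only [transpose_mul, transpose_transpose, Matrix.mul_assoc]
        using congr_arg Matrix.transpose hc.right
    simp only [LayerMem.proj_of_not_le hmn, LayerMem.direction, updateMem, if_neg hmn]
    split_ifs <;> simp only [Matrix.add_mul, Matrix.smul_mul, Matrix.mul_assoc, hQ]

variable {t}

theorem proj_updateMem_of_mod_ne_zero (ht : t % H.τ ≠ 0) :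
    (updateMem h H t G s c).proj = c.proj := by
  simp only [updateMem, LayerMem.proj, if_neg ht]
  split_ifs <;> rfl

theorem frobSq_sub_proj_updateMem_le (hs : IsSVD G s) (ht : t % H.τ = 0) :
    frobSq (G - (updateMem h H t G s c).proj G) ≤
      (1 - (r : ℝ) / (min m n : ℕ)) * frobSq G := by
  by_cases hmn : m ≤ n
  · rw [LayerMem.proj_of_le hmn, min_eq_left hmn]
    simp only [updateMem, if_pos ht, if_pos hmn]
    exact hs.frobSq_sub_firstCols_mul_le hmn (h.trans (min_le_left m n))
  · have hnm : n ≤ m := (not_le.1 hmn).le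
    rw [LayerMem.proj_of_not_le hmn, min_eq_right hnm, ← frobSq_transpose G,
      ← frobSq_transpose (G - _)]
    simp only [updateMem, if_pos ht, if_neg hmn, transpose_sub, transpose_mul,
      transpose_transpose]
    exact hs.transpose.frobSq_sub_firstCols_mul_le hnm (h.trans (min_le_right m n))

end LayerMem

/-! ### The projection of the parameter space -/

namespace Arch

variable (A : Arch)

theorem delta_pos (l : Fin A.N) : 0 < A.delta l := by
  have hmin : 0 < min (A.m l) (A.n l) := (A.r_pos l).trans_le (A.r_le l)
  have hr := A.r_pos l
  unfold delta
  positivity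

theorem delta_le_one (l : Fin A.N) : A.delta l ≤ 1 :=
  div_le_one_of_le₀ (by exact_mod_cast A.r_le l) (Nat.cast_nonneg _)

theorem minDelta_le (l : Fin A.N) : A.minDelta ≤ A.delta l :=
  ciInf_le (Set.finite_range _).bddBelow l

theorem minDelta_pos : 0 < A.minDelta := by
  have : Nonempty (Fin A.N) := ⟨⟨0, A.N_pos⟩⟩
  obtain ⟨l, hl⟩ := exists_eq_ciInf_of_finite (f := A.delta)
  exact (A.delta_pos l).trans_eq hl

theorem minDelta_le_one : A.minDelta ≤ 1 :=
  (A.minDelta_le ⟨0, A.N_pos⟩).trans (A.delta_le_one _)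

/-- The memory of all layers. -/
abbrev Memory : Type := ∀ l : Fin A.N, LayerMem (A.m l) (A.n l) (A.r l)

end Arch

section Params

variable {A : Arch}

theorem params_ext {x y : A.Params} (h : ∀ l, layer x l = layer y l) : x = y := by
  ext ⟨l, i, j⟩
  exact congr_fun₂ (h l) i j

theorem layer_add (x y : A.Params) (l : Fin A.N) : layer (x + y) l = layer x l + layer y l := rfl

theorem layer_sub (x y : A.Params) (l : Fin A.N) : layer (x - y) l = layer x l - layer y l := rfl

theorem layer_smul (a : ℝ) (x : A.Params) (l : Fin A.N) : layer (a • x) l = a • layer x l := rfl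

theorem layer_ofLayers (X : ∀ l : Fin A.N, Matrix (Fin (A.m l)) (Fin (A.n l)) ℝ) (l : Fin A.N) :
    layer (ofLayers X) l = X l := rfl

theorem inner_eq_sum_trace (x y : A.Params) :
    inner ℝ x y = ∑ l, ((layer x l).transpose * layer y l).trace := by
  rw [PiLp.inner_apply, Fintype.sum_sigma]
  refine Finset.sum_congr rfl fun l _ => ?_
  rw [Fintype.sum_prod_type, Finset.sum_comm]
  simp [Matrix.trace, Matrix.mul_apply, layer, mul_comm]

theorem norm_sq_eq_sum_frobSq (x : A.Params) : ‖x‖ ^ 2 = ∑ l, frobSq (layer x l) := by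
  rw [← real_inner_self_eq_norm_sq, inner_eq_sum_trace]
  simp_rw [frobSq_eq_trace]

/-- The projection of the parameter space onto the subspaces held in memory. -/
noncomputable def memProj (mem : A.Memory) : A.Params →ₗ[ℝ] A.Params where
  toFun x := ofLayers fun l => (mem l).proj (layer x l)
  map_add' x y := params_ext fun l => by
    simp only [layer_ofLayers, layer_add, map_add]
  map_smul' a x := params_ext fun l => by
    simp only [layer_ofLayers, layer_smul, map_smul, RingHom.id_apply]

/-- The momentum as a vector of the parameter space. -/
noncomputable def memDirection (mem : A.Memory) : A.Params :=
  ofLayers fun l => (mem l).direction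

theorem layer_memProj (mem : A.Memory) (x : A.Params) (l : Fin A.N) :
    layer (memProj mem x) l = (mem l).proj (layer x l) := rfl

theorem layer_memDirection (mem : A.Memory) (l : Fin A.N) :
    layer (memDirection mem) l = (mem l).direction := rfl

theorem memProj_isSymmetricProjection {mem : A.Memory} (h : ∀ l, (mem l).IsPartialIsometry) :
    (memProj mem).IsSymmetricProjection where
  isIdempotentElem := LinearMap.ext fun x => params_ext fun l => (h l).proj_proj (layer x l)
  isSymmetric x y := by
    simp only [inner_eq_sum_trace, layer_memProj, LayerMem.trace_transpose_proj_mul]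

end Params

/-! ### One iteration of the algorithm -/

section Run

variable {A : Arch} {Ξ : Type*} {H : Hyper} {F : A.Params → Ξ → ℝ} {svd : SVDRule A}
  {x0 : A.Params} {z : ℕ → ℕ → Ξ}

/-- The gradient estimate as a vector of the parameter space. -/
noncomputable def gradEstVec (H : Hyper) (F : A.Params → Ξ → ℝ) (t : ℕ)
    (x : A.Params) (z : ℕ → Ξ) : A.Params :=
  ofLayers (gradEst H F t x z)

theorem layer_gradEstVec (t : ℕ) (x : A.Params) (z : ℕ → Ξ) (l : Fin A.N) :
    layer (gradEstVec H F t x z) l = gradEst H F t x z l := rfl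

theorem x_run_succ (t : ℕ) :
    (run H F svd x0 z (t + 1)).x =
      (run H F svd x0 z t).x - H.η • memDirection (run H F svd x0 z (t + 1)).mem := rfl

theorem mem_run_succ (t : ℕ) (l : Fin A.N) :
    (run H F svd x0 z (t + 1)).mem l = updateMem (A.r_le l) H t
      (gradEst H F t (run H F svd x0 z t).x (z t) l)
      (svd t l (gradEst H F t (run H F svd x0 z t).x (z t) l)) ((run H F svd x0 z t).mem l) := rfl

theorem run_isPartialIsometry (hs : ∀ t l G, IsSVD G (svd t l G)) (t : ℕ) (l : Fin A.N) :
    ((run H F svd x0 z t).mem l).IsPartialIsometry := by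
  induction t with
  | zero => exact ⟨by simp [run, initState], by simp [run, initState]⟩
  | succ t ih =>
    rw [mem_run_succ]
    exact updateMem_isPartialIsometry _ _ _ (hs _ _ _) ih

theorem memDirection_run_zero : memDirection (run H F svd x0 z 0).mem = 0 :=
  params_ext fun l => by
    simp only [layer_memDirection, run, initState, LayerMem.direction, Matrix.zero_mul, ite_self]
    rfl

theorem memDirection_run_succ (hs : ∀ t l G, IsSVD G (svd t l G)) (t : ℕ) :
    memDirection (run H F svd x0 z (t + 1)).mem = memProj (run H F svd x0 z (t + 1)).mem
      ((1 - H.β) • memDirection (run H F svd x0 z t).mem +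
        H.β • gradEstVec H F t (run H F svd x0 z t).x (z t)) :=
  params_ext fun l => by
    rw [layer_memProj, layer_memDirection, mem_run_succ, layer_add, layer_smul, layer_smul,
      layer_memDirection, layer_gradEstVec]
    exact direction_updateMem _ _ _ (run_isPartialIsometry hs t l)

theorem memProj_run_zero : memProj (run H F svd x0 z 0).mem = 0 :=
  LinearMap.ext fun x => params_ext fun l => by
    rw [layer_memProj]
    by_cases hmn : A.m l ≤ A.n l
    · rw [LayerMem.proj_of_le hmn, run, initState, Matrix.zero_mul, Matrix.zero_mul]; rfl
    · rw [LayerMem.proj_of_not_le hmn, run, initState, Matrix.zero_mul, Matrix.mul_zero]; rfl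

theorem memProj_run_succ {t : ℕ} (ht : t % H.τ ≠ 0) :
    memProj (run H F svd x0 z (t + 1)).mem = memProj (run H F svd x0 z t).mem :=
  LinearMap.ext fun x => params_ext fun l => by
    rw [layer_memProj, layer_memProj, mem_run_succ, proj_updateMem_of_mod_ne_zero _ H ht]

theorem norm_gradEstVec_sub_memProj_sq_le (hs : ∀ t l G, IsSVD G (svd t l G)) {t : ℕ}
    (ht : t % H.τ = 0) :
    ‖gradEstVec H F t (run H F svd x0 z t).x (z t) - memProj (run H F svd x0 z (t + 1)).mem
      (gradEstVec H F t (run H F svd x0 z t).x (z t))‖ ^ 2 ≤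
      (1 - A.minDelta) * ‖gradEstVec H F t (run H F svd x0 z t).x (z t)‖ ^ 2 := by
  rw [norm_sq_eq_sum_frobSq, norm_sq_eq_sum_frobSq, Finset.mul_sum]
  refine Finset.sum_le_sum fun l _ => ?_
  rw [layer_sub, layer_memProj, layer_gradEstVec, mem_run_succ]
  refine (frobSq_sub_proj_updateMem_le _ H (hs _ _ _) ht).trans
    (mul_le_mul_of_nonneg_right ?_ (frobSq_nonneg _))
  exact sub_le_sub_left (A.minDelta_le l) 1

end Run

/-! ### Centred noise evaluated at independent samples -/

section Samples

variable {ι Ω Ξ : Type*} [MeasurableSpace Ξ]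

/-- The `σ`-algebra generated by the samples `ζ i` with index in `I`. -/
@[reducible]
def sampleAlgebra (ζ : ι → Ω → Ξ) (I : Set ι) : MeasurableSpace Ω :=
  ⨆ i ∈ I, MeasurableSpace.comap (ζ i) inferInstance

variable {ζ : ι → Ω → Ξ} {I J : Set ι} {i : ι}

theorem measurable_sampleAlgebra (hi : i ∈ I) : Measurable[sampleAlgebra ζ I] (ζ i) :=
  measurable_iff_comap_le.2 (le_iSup₂ (f := fun i (_ : i ∈ I) =>
    MeasurableSpace.comap (ζ i) inferInstance) i hi)

theorem sampleAlgebra_mono (h : I ⊆ J) : sampleAlgebra ζ I ≤ sampleAlgebra ζ J :=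
  biSup_mono fun _ hi => h hi

variable [mΩ : MeasurableSpace Ω] {μ : Measure Ω}

theorem sampleAlgebra_le (hζ : ∀ i, Measurable (ζ i)) (I : Set ι) : sampleAlgebra ζ I ≤ mΩ :=
  iSup₂_le fun i _ => (hζ i).comap_le

theorem indepFun_of_measurable_sampleAlgebra (hζ : ∀ i, Measurable (ζ i)) (hind : iIndepFun ζ μ)
    (hi : i ∉ I) {β : Type*} [MeasurableSpace β] {X : Ω → β}
    (hX : Measurable[sampleAlgebra ζ I] X) : IndepFun X (ζ i) μ := by
  have hdisj : Disjoint I {i} := Set.disjoint_singleton_right.2 hi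
  have hindep := indep_iSup_of_disjoint (fun i => (hζ i).comap_le)
    ((iIndepFun_iff_iIndep _ _ _).1 hind) hdisj
  rw [IndepFun_iff_Indep]
  exact indep_of_indep_of_le hindep (measurable_iff_comap_le.1 hX)
    (measurable_iff_comap_le.1 (measurable_sampleAlgebra (Set.mem_singleton i)))

end Samples

/-- A measurable map `g` whose values `g x ξ` at every fixed `x`, under `ξ ∼ D`, are centred with
mean square at most `s`; the stochastic gradient error is of this kind. -/
structure CenteredNoise {α Ξ E : Type*} [MeasurableSpace α] [MeasurableSpace Ξ]
    [NormedAddCommGroup E] [NormedSpace ℝ E] [MeasurableSpace E] (D : Measure Ξ)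
    (g : α → Ξ → E) (s : ℝ) : Prop where
  measurable : Measurable (Function.uncurry g)
  memLp : ∀ x, MemLp (g x) 2 D
  integral_eq_zero : ∀ x, ∫ z, g x z ∂D = 0
  meanSq_le : ∀ x, meanSq D (g x) ≤ s

theorem measurePreserving_prodMk_of_indepFun {Ω α Ξ : Type*} [MeasurableSpace Ω]
    [MeasurableSpace α] [MeasurableSpace Ξ] {μ : Measure Ω} [IsFiniteMeasure μ] {D : Measure Ξ}
    {X : Ω → α} {ζ : Ω → Ξ} (hX : Measurable X) (hζ : MeasurePreserving ζ μ D)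
    (h : IndepFun X ζ μ) :
    MeasurePreserving (fun ω => (X ω, ζ ω)) μ ((μ.map X).prod D) where
  measurable := hX.prodMk hζ.measurable
  map_eq := by
    rw [(indepFun_iff_map_prod_eq_prod_map_map hX.aemeasurable hζ.measurable.aemeasurable).1 h,
      hζ.map_eq]

namespace CenteredNoise

variable {α Ξ E : Type*} [MeasurableSpace α] [MeasurableSpace Ξ] [NormedAddCommGroup E]
  [InnerProductSpace ℝ E] [MeasurableSpace E] [BorelSpace E] [SecondCountableTopology E]
  {D : Measure Ξ} {g : α → Ξ → E} {s : ℝ}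

omit [BorelSpace E] [SecondCountableTopology E] in
theorem measurable_comp (hg : CenteredNoise D g s) {Ω : Type*} {_ : MeasurableSpace Ω}
    {X : Ω → α} {ζ : Ω → Ξ} (hX : Measurable X) (hζ : Measurable ζ) :
    Measurable fun ω => g (X ω) (ζ ω) :=
  hg.measurable.comp (hX.prodMk hζ)

section Independent

variable {Ω : Type*} [MeasurableSpace Ω] {μ : Measure Ω} [IsProbabilityMeasure μ] [SFinite D]
  {X : Ω → α} {ζ : Ω → Ξ}

omit [SecondCountableTopology E] in
theorem integrable_norm_sq_prod (hg : CenteredNoise D g s) (ν : Measure α) [IsFiniteMeasure ν] :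
    Integrable (fun q : α × Ξ => ‖g q.1 q.2‖ ^ 2) (ν.prod D) := by
  have hsq : StronglyMeasurable fun q : α × Ξ => ‖g q.1 q.2‖ ^ 2 :=
    (hg.measurable.norm.pow_const 2).stronglyMeasurable
  refine (integrable_prod_iff hsq.aestronglyMeasurable).2
    ⟨.of_forall fun x => integrable_norm_sq (hg.memLp x), ?_⟩
  refine (integrable_const s).mono' (by exact hsq.norm.integral_prod_right.aestronglyMeasurable)
    (.of_forall fun x => ?_)
  simp only [norm_pow, norm_norm]
  rw [Real.norm_of_nonneg (integral_nonneg fun _ => sq_nonneg _)]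
  exact hg.meanSq_le x

theorem memLp_comp (hg : CenteredNoise D g s) (hX : Measurable X) (hζ : MeasurePreserving ζ μ D)
    (hind : IndepFun X ζ μ) : MemLp (fun ω => g (X ω) (ζ ω)) 2 μ := by
  refine (memLp_two_iff_integrable_sq_norm
    (hg.measurable_comp hX hζ.measurable).aestronglyMeasurable).2 ?_
  exact (measurePreserving_prodMk_of_indepFun hX hζ hind).integrable_comp_of_integrable
    (hg.integrable_norm_sq_prod (μ.map X))

omit [SecondCountableTopology E] in
theorem meanSq_comp_le (hg : CenteredNoise D g s) (hX : Measurable X)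
    (hζ : MeasurePreserving ζ μ D) (hind : IndepFun X ζ μ) :
    meanSq μ (fun ω => g (X ω) (ζ ω)) ≤ s := by
  have := Measure.isProbabilityMeasure_map (μ := μ) hX.aemeasurable
  have hint := hg.integrable_norm_sq_prod (μ.map X)
  have hXζ := measurePreserving_prodMk_of_indepFun hX hζ hind
  calc meanSq μ (fun ω => g (X ω) (ζ ω))
      = ∫ q, ‖g q.1 q.2‖ ^ 2 ∂(μ.map X).prod D := by
        rw [← hXζ.map_eq, integral_map hXζ.measurable.aemeasurable]
        · rfl
        · rw [hXζ.map_eq]; exact hint.aestronglyMeasurable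
    _ = ∫ x, meanSq D (g x) ∂μ.map X := integral_prod _ hint
    _ ≤ ∫ _, s ∂μ.map X := integral_mono hint.integral_prod_left (integrable_const s) hg.meanSq_le
    _ = s := by simp

theorem integral_inner_comp [CompleteSpace E] [IsFiniteMeasure D] (hg : CenteredNoise D g s)
    {Y : Ω → E} (hX : Measurable X) (hY : Measurable Y) (hY2 : MemLp Y 2 μ)
    (hζ : MeasurePreserving ζ μ D)
    (hind : IndepFun (fun ω => (Y ω, X ω)) ζ μ) :
    ∫ ω, inner ℝ (Y ω) (g (X ω) (ζ ω)) ∂μ = 0 := by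
  have hind' : IndepFun X ζ μ := hind.comp measurable_snd measurable_id
  have hYX := measurePreserving_prodMk_of_indepFun (hY.prodMk hX) hζ hind
  have hmeas : StronglyMeasurable fun q : (E × α) × Ξ => (inner ℝ q.1.1 (g q.1.2 q.2) : ℝ) :=
    ((measurable_fst.comp measurable_fst).inner (hg.measurable_comp
      (measurable_snd.comp measurable_fst) measurable_snd)).stronglyMeasurable
  have hint : Integrable (fun q : (E × α) × Ξ => (inner ℝ q.1.1 (g q.1.2 q.2) : ℝ))
      ((μ.map fun ω => (Y ω, X ω)).prod D) :=
    (hYX.integrable_comp hmeas.aestronglyMeasurable).1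
      (integrable_inner_of_memLp hY2 (hg.memLp_comp hX hζ hind'))
  calc ∫ ω, inner ℝ (Y ω) (g (X ω) (ζ ω)) ∂μ
      = ∫ q, inner ℝ q.1.1 (g q.1.2 q.2) ∂(μ.map fun ω => (Y ω, X ω)).prod D := by
        rw [← hYX.map_eq, integral_map hYX.measurable.aemeasurable hmeas.aestronglyMeasurable]
    _ = ∫ q, ∫ z, inner ℝ q.1 (g q.2 z) ∂D ∂μ.map fun ω => (Y ω, X ω) := integral_prod _ hint
    _ = 0 := by
        simp only [integral_inner ((hg.memLp _).integrable one_le_two), hg.integral_eq_zero,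
          inner_zero_right, integral_zero]

end Independent

section Batch

variable {ι Ω : Type*} [mΩ : MeasurableSpace Ω] {μ : Measure Ω} [IsProbabilityMeasure μ]
  {ζ : ι → Ω → Ξ} {I : Set ι} {b : Finset ι} {X : Ω → α}

theorem memL2_sum_comp [SFinite D] (hg : CenteredNoise D g s)
    (hζ : ∀ i, MeasurePreserving (ζ i) μ D) (hind : iIndepFun ζ μ) (hb : ∀ i ∈ b, i ∉ I)
    (hX : Measurable[sampleAlgebra ζ I] X) :
    MemL2 (sampleAlgebra ζ (I ∪ b)) μ fun ω => ∑ i ∈ b, g (X ω) (ζ i ω) where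
  stronglyMeasurable := Measurable.stronglyMeasurable <| Finset.measurable_fun_sum _ fun _ hi =>
    hg.measurable_comp (hX.mono (sampleAlgebra_mono Set.subset_union_left) le_rfl)
      (measurable_sampleAlgebra (Or.inr hi))
  memLp := by
    have hm := fun i => (hζ i).measurable
    exact memLp_finsetSum _ fun i hi => hg.memLp_comp (hX.mono (sampleAlgebra_le hm I) le_rfl)
      (hζ i) (indepFun_of_measurable_sampleAlgebra hm hind (hb i hi) hX)

variable [CompleteSpace E] [IsFiniteMeasure D]

theorem integral_inner_sample (hg : CenteredNoise D g s)
    (hζ : ∀ i, MeasurePreserving (ζ i) μ D) (hind : iIndepFun ζ μ) {i : ι} (hi : i ∉ I)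
    (hX : Measurable[sampleAlgebra ζ I] X) {Y : Ω → E} (hY : MemL2 (sampleAlgebra ζ I) μ Y) :
    ∫ ω, inner ℝ (Y ω) (g (X ω) (ζ i ω)) ∂μ = 0 := by
  have hm := fun i => (hζ i).measurable
  have hle := sampleAlgebra_le hm I
  have hY' := hY.stronglyMeasurable.measurable
  exact hg.integral_inner_comp (hX.mono hle le_rfl) (hY'.mono hle le_rfl) hY.memLp (hζ i)
    (indepFun_of_measurable_sampleAlgebra hm hind hi (hY'.prodMk hX))

theorem integral_inner_sum (hg : CenteredNoise D g s)
    (hζ : ∀ i, MeasurePreserving (ζ i) μ D) (hind : iIndepFun ζ μ) (hb : ∀ i ∈ b, i ∉ I)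
    (hX : Measurable[sampleAlgebra ζ I] X) {Y : Ω → E} (hY : MemL2 (sampleAlgebra ζ I) μ Y) :
    ∫ ω, inner ℝ (Y ω) (∑ i ∈ b, g (X ω) (ζ i ω)) ∂μ = 0 := by
  have hm := fun i => (hζ i).measurable
  simp_rw [inner_sum]
  rw [integral_finsetSum _ fun i hi => integrable_inner_of_memLp hY.memLp
    (hg.memLp_comp (hX.mono (sampleAlgebra_le hm I) le_rfl) (hζ i)
      (indepFun_of_measurable_sampleAlgebra hm hind (hb i hi) hX))]
  exact Finset.sum_eq_zero fun i hi => hg.integral_inner_sample hζ hind (hb i hi) hX hY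

theorem meanSq_sum_le (hg : CenteredNoise D g s)
    (hζ : ∀ i, MeasurePreserving (ζ i) μ D) (hind : iIndepFun ζ μ) (hb : ∀ i ∈ b, i ∉ I)
    (hX : Measurable[sampleAlgebra ζ I] X) :
    meanSq μ (fun ω => ∑ i ∈ b, g (X ω) (ζ i ω)) ≤ b.card * s := by
  classical
  induction b using Finset.induction_on with
  | empty => simp [meanSq]
  | insert i b hib ih =>
    rw [Finset.forall_mem_insert] at hb
    have hm := fun i => (hζ i).measurable
    have hnew : i ∉ I ∪ b := fun h => h.elim hb.1 hib
    have hX' : Measurable[sampleAlgebra ζ (I ∪ b)] X :=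
      hX.mono (sampleAlgebra_mono Set.subset_union_left) le_rfl
    have hXm : Measurable X := hX.mono (sampleAlgebra_le hm I) le_rfl
    have hindep := indepFun_of_measurable_sampleAlgebra hm hind hb.1 hX
    have hsum := hg.memL2_sum_comp hζ hind hb.2 hX
    have pythagoras := meanSq_add_of_integral_inner_eq_zero hsum.memLp
      (hg.memLp_comp hXm (hζ i) hindep) (hg.integral_inner_sample hζ hind hnew hX' hsum)
    simp_rw [Finset.sum_insert hib, Finset.card_insert_of_notMem hib, add_comm (g _ _)]
    refine pythagoras.trans_le ?_
    push_cast
    linarith [ih hb.2, hg.meanSq_comp_le hXm (hζ i) hindep]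

end Batch

end CenteredNoise

/-! ### The error of the stochastic gradient -/

section SampleNoise

theorem gradient_apply {ι : Type*} [Fintype ι] [DecidableEq ι] (f : EuclideanSpace ℝ ι → ℝ)
    (x : EuclideanSpace ℝ ι) (i : ι) :
    gradient f x i = fderiv ℝ f x (EuclideanSpace.single i 1) := by
  rw [← inner_gradient_left, EuclideanSpace.inner_single_right, one_mul, conj_trivial]

theorem measurable_gradient_uncurry {ι Ξ : Type*} [Fintype ι] [MeasurableSpace Ξ]
    {F : EuclideanSpace ℝ ι → Ξ → ℝ} (hm : ∀ x, Measurable (F x))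
    (hd : ∀ z, Differentiable ℝ fun x => F x z) :
    Measurable fun q : EuclideanSpace ℝ ι × Ξ => gradient (fun y => F y q.2) q.1 := by
  classical
  have hF : Measurable (Function.uncurry F) :=
    measurable_uncurry_of_continuous_of_measurable (fun z => (hd z).continuous) hm
  refine (WithLp.measurable_toLp 2 _).comp (measurable_pi_lambda _ fun i => ?_)
  change Measurable fun q : EuclideanSpace ℝ ι × Ξ => gradient (fun y => F y q.2) q.1 i
  simp_rw [gradient_apply]
  refine measurable_of_tendsto_metrizable (f := fun (k : ℕ) (q : EuclideanSpace ℝ ι × Ξ) =>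
    (k : ℝ) • (F (q.1 + (k : ℝ)⁻¹ • EuclideanSpace.single i 1) q.2 - F q.1 q.2)) (fun k => ?_) ?_
  · have hshift : Measurable fun q : EuclideanSpace ℝ ι × Ξ =>
        F (q.1 + (k : ℝ)⁻¹ • EuclideanSpace.single i 1) q.2 :=
      hF.comp ((measurable_fst.add_const _).prodMk measurable_snd)
    exact (hshift.sub hF).const_smul (k : ℝ)
  · rw [tendsto_pi_nhds]
    intro q
    refine (hd q.2 q.1).hasFDerivAt.lim (EuclideanSpace.single i 1) ?_
    simpa using tendsto_natCast_atTop_atTop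

variable {A : Arch} {Ξ : Type*} [MeasurableSpace Ξ] {D : Measure Ξ} {F : A.Params → Ξ → ℝ}
  {σ : Fin A.N → ℝ}

/-- The error of the stochastic gradient of the sample `z` at `x`. -/
noncomputable def sampleNoise (D : Measure Ξ) (F : A.Params → Ξ → ℝ) (x : A.Params) (z : Ξ) :
    A.Params :=
  gradient (fun y => F y z) x - gradient (objective D F) x

theorem norm_sampleNoise_sq (x : A.Params) (z : Ξ) :
    ‖sampleNoise D F x z‖ ^ 2 =
      ∑ l, frobSq (layerGrad (fun y => F y z) x l - layerGrad (objective D F) x l) :=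
  norm_sq_eq_sum_frobSq _

theorem meanSq_sampleNoise_le (hF : StochasticGradient D F σ) (x : A.Params) :
    meanSq D (sampleNoise D F x) ≤ totalSigma σ ^ 2 := by
  simp only [meanSq, norm_sampleNoise_sq]
  rw [integral_finsetSum _ fun l _ => hF.variance_integrable x l, totalSigma,
    Real.sq_sqrt (Finset.sum_nonneg fun l _ => sq_nonneg _)]
  exact Finset.sum_le_sum fun l _ => hF.variance_le x l

theorem measurable_sampleNoise_uncurry (hF : StochasticGradient D F σ)
    (hc : Continuous (gradient (objective D F))) :
    Measurable (Function.uncurry (sampleNoise D F)) :=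
  (measurable_gradient_uncurry hF.measurable hF.differentiable).sub
    (hc.measurable.comp measurable_fst)

theorem memLp_sampleNoise (hF : StochasticGradient D F σ)
    (hc : Continuous (gradient (objective D F))) (x : A.Params) :
    MemLp (sampleNoise D F x) 2 D := by
  refine (memLp_two_iff_integrable_sq_norm ((measurable_sampleNoise_uncurry hF hc).comp
    measurable_prodMk_left).aestronglyMeasurable).2 ?_
  simp only [Function.comp_apply, Function.uncurry_apply_pair, norm_sampleNoise_sq]
  exact integrable_finsetSum _ fun l _ => hF.variance_integrable x l

theorem integral_sampleNoise [IsProbabilityMeasure D] (hF : StochasticGradient D F σ)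
    (hc : Continuous (gradient (objective D F))) (x : A.Params) :
    ∫ z, sampleNoise D F x z ∂D = 0 := by
  have hint : ∀ i, Integrable (fun z => sampleNoise D F x z i) D := fun i =>
    ((memLp_sampleNoise hF hc x).integrable one_le_two).eval_piLp i
  ext ⟨l, i, j⟩
  have unbiased := hF.unbiased x l i j
  have hadd : ∀ z, layerGrad (fun y => F y z) x l i j =
      sampleNoise D F x z ⟨l, i, j⟩ + layerGrad (objective D F) x l i j := fun z =>
    (sub_add_cancel _ _).symm
  simp_rw [hadd] at unbiased
  rw [integral_add (hint _) (integrable_const _), integral_const, probReal_univ, one_smul,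
    add_eq_right] at unbiased
  rw [eval_integral_piLp hint]
  exact unbiased

theorem centeredNoise_sampleNoise [IsProbabilityMeasure D] (hF : StochasticGradient D F σ)
    (hc : Continuous (gradient (objective D F))) :
    CenteredNoise D (sampleNoise D F) (totalSigma σ ^ 2) where
  measurable := measurable_sampleNoise_uncurry hF hc
  memLp := memLp_sampleNoise hF hc
  integral_eq_zero := integral_sampleNoise hF hc
  meanSq_le := meanSq_sampleNoise_le hF

end SampleNoise

/-! ### Measurability of the iterates -/

section Measurability

variable {Ω : Type*} [mΩ : MeasurableSpace Ω]

/-- Measurability of a random matrix, entry by entry. (Mathlib puts no `σ`-algebra on `Matrix`.) -/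
def EntryMeasurable {m n : ℕ} (M : Ω → Matrix (Fin m) (Fin n) ℝ) : Prop :=
  ∀ i j, Measurable fun ω => M ω i j

namespace EntryMeasurable

variable {m n k : ℕ} {M M' : Ω → Matrix (Fin m) (Fin n) ℝ}

theorem mul {M' : Ω → Matrix (Fin n) (Fin k) ℝ} (h : EntryMeasurable M) (h' : EntryMeasurable M') :
    EntryMeasurable fun ω => M ω * M' ω := fun i j => by
  simp only [Matrix.mul_apply]
  exact Finset.measurable_fun_sum _ fun k _ => (h i k).mul (h' k j)

theorem transpose (h : EntryMeasurable M) : EntryMeasurable fun ω => (M ω).transpose :=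
  fun i j => h j i

theorem add (h : EntryMeasurable M) (h' : EntryMeasurable M') :
    EntryMeasurable fun ω => M ω + M' ω := fun i j => (h i j).add (h' i j)

theorem sub (h : EntryMeasurable M) (h' : EntryMeasurable M') :
    EntryMeasurable fun ω => M ω - M' ω := fun i j => (h i j).sub (h' i j)

theorem const_smul (h : EntryMeasurable M) (a : ℝ) : EntryMeasurable fun ω => a • M ω :=
  fun i j => (h i j).const_mul a

theorem sum {ι : Type*} {I : Finset ι} {M : ι → Ω → Matrix (Fin m) (Fin n) ℝ}
    (h : ∀ b ∈ I, EntryMeasurable (M b)) : EntryMeasurable fun ω => ∑ b ∈ I, M b ω := fun i j => by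
  simp only [Matrix.sum_apply]
  exact Finset.measurable_fun_sum _ fun b hb => h b hb i j

theorem firstCols {r : ℕ} (h : r ≤ m) {U : Ω → Matrix (Fin m) (Fin m) ℝ}
    (hU : EntryMeasurable U) : EntryMeasurable fun ω => GaLore.firstCols h (U ω) :=
  fun i j => hU i (Fin.castLE h j)

end EntryMeasurable

/-- Measurability of a random layer memory. -/
structure MemMeasurable {m n r : ℕ} (c : Ω → LayerMem m n r) : Prop where
  P : EntryMeasurable fun ω => (c ω).P
  Q : EntryMeasurable fun ω => (c ω).Q
  Mleft : EntryMeasurable fun ω => (c ω).Mleft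
  Mright : EntryMeasurable fun ω => (c ω).Mright

namespace MemMeasurable

variable {m n r : ℕ} {G : Ω → Matrix (Fin m) (Fin n) ℝ} {s : Ω → SVDFactors m n}
  {c : Ω → LayerMem m n r}

theorem updateMem (hc : MemMeasurable c) (h : r ≤ min m n) (H : Hyper) (t : ℕ)
    (hG : EntryMeasurable G) (hU : EntryMeasurable fun ω => (s ω).U)
    (hV : EntryMeasurable fun ω => (s ω).V) :
    MemMeasurable fun ω => GaLore.updateMem h H t (G ω) (s ω) (c ω) := by
  unfold GaLore.updateMem
  split_ifs
  · have hP := hU.firstCols (h.trans (min_le_left m n))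
    exact ⟨hP, hc.Q, (((hP.transpose.mul hc.P).mul hc.Mleft).const_smul _).add
      ((hP.transpose.mul hG).const_smul _), hc.Mright⟩
  · have hQ := hV.firstCols (h.trans (min_le_right m n))
    exact ⟨hc.P, hQ, hc.Mleft, (((hc.Mright.mul hc.Q.transpose).mul hQ).const_smul _).add
      ((hG.mul hQ).const_smul _)⟩
  · exact ⟨hc.P, hc.Q, (hc.Mleft.const_smul _).add ((hc.P.transpose.mul hG).const_smul _),
      hc.Mright⟩
  · exact ⟨hc.P, hc.Q, hc.Mleft, (hc.Mright.const_smul _).add ((hG.mul hc.Q).const_smul _)⟩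

theorem direction (hc : MemMeasurable c) : EntryMeasurable fun ω => (c ω).direction := by
  unfold LayerMem.direction
  split_ifs
  · exact hc.P.mul hc.Mleft
  · exact hc.Mright.mul hc.Q.transpose

theorem proj (hc : MemMeasurable c) (hG : EntryMeasurable G) :
    EntryMeasurable fun ω => (c ω).proj (G ω) := by
  by_cases hmn : m ≤ n
  · simp only [LayerMem.proj_of_le hmn]
    exact (hc.P.mul hc.P.transpose).mul hG
  · simp only [LayerMem.proj_of_not_le hmn]
    exact hG.mul (hc.Q.mul hc.Q.transpose)

end MemMeasurable

variable {A : Arch}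

theorem EntryMeasurable.ofLayers {X : Ω → ∀ l : Fin A.N, Matrix (Fin (A.m l)) (Fin (A.n l)) ℝ}
    (h : ∀ l, EntryMeasurable fun ω => X ω l) : Measurable fun ω => GaLore.ofLayers (X ω) :=
  (WithLp.measurable_toLp 2 _).comp (measurable_pi_lambda _ fun p => h p.1 p.2.1 p.2.2)

theorem entryMeasurable_layer {x : Ω → A.Params} (h : Measurable x) (l : Fin A.N) :
    EntryMeasurable fun ω => layer (x ω) l := fun i j =>
  (measurable_pi_iff.1 ((WithLp.measurable_ofLp 2 _).comp h)) ⟨l, i, j⟩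

theorem measurable_memProj {mem : Ω → A.Memory} (h : ∀ l, MemMeasurable fun ω => mem ω l)
    {v : Ω → A.Params} (hv : Measurable v) : Measurable fun ω => memProj (mem ω) (v ω) :=
  EntryMeasurable.ofLayers fun l => (h l).proj (entryMeasurable_layer hv l)

theorem SVDRule.Valid.entryMeasurable_U {svd : SVDRule A} (hs : svd.Valid) (t : ℕ) (l : Fin A.N)
    {G : Ω → Matrix (Fin (A.m l)) (Fin (A.n l)) ℝ} (hG : EntryMeasurable G) :
    EntryMeasurable fun ω => (svd t l (G ω)).U := fun i k =>
  (hs.measurable_U t l i k).comp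
    (measurable_pi_lambda _ fun i => measurable_pi_lambda _ fun j => hG i j)

theorem SVDRule.Valid.entryMeasurable_V {svd : SVDRule A} (hs : svd.Valid) (t : ℕ) (l : Fin A.N)
    {G : Ω → Matrix (Fin (A.m l)) (Fin (A.n l)) ℝ} (hG : EntryMeasurable G) :
    EntryMeasurable fun ω => (svd t l (G ω)).V := fun j k =>
  (hs.measurable_V t l j k).comp
    (measurable_pi_lambda _ fun i => measurable_pi_lambda _ fun j => hG i j)

variable {Ξ : Type*} [MeasurableSpace Ξ] {F : A.Params → Ξ → ℝ}

theorem entryMeasurable_gradEst (hm : ∀ x, Measurable (F x))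
    (hd : ∀ z, Differentiable ℝ fun x => F x z) (H : Hyper) (t : ℕ) {x : Ω → A.Params}
    (hx : Measurable x) {z : Ω → ℕ → Ξ} (hz : ∀ b, Measurable fun ω => z ω b) (l : Fin A.N) :
    EntryMeasurable fun ω => gradEst H F t (x ω) (z ω) l := by
  have h : ∀ b, EntryMeasurable fun ω => layerGrad (fun y => F y (z ω b)) (x ω) l := fun b =>
    entryMeasurable_layer ((measurable_gradient_uncurry hm hd).comp (hx.prodMk (hz b))) l
  unfold gradEst
  split_ifs
  · exact (EntryMeasurable.sum fun b _ => h b).const_smul _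
  · exact h 0

/-- Measurability of a random state of the algorithm. -/
structure StateMeasurable (s : Ω → State A) : Prop where
  x : Measurable fun ω => (s ω).x
  mem : ∀ l, MemMeasurable fun ω => (s ω).mem l

theorem StateMeasurable.step (hm : ∀ x, Measurable (F x))
    (hd : ∀ z, Differentiable ℝ fun x => F x z) {svd : SVDRule A} (hs : svd.Valid) (H : Hyper)
    (t : ℕ) {z : Ω → ℕ → Ξ} (hz : ∀ b, Measurable fun ω => z ω b) {s : Ω → State A}
    (h : StateMeasurable s) : StateMeasurable fun ω => GaLore.step H F svd t (z ω) (s ω) := by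
  have hmem : ∀ l, MemMeasurable fun ω => (GaLore.step H F svd t (z ω) (s ω)).mem l := fun l => by
    have hG := entryMeasurable_gradEst hm hd H t h.x hz l
    exact (h.mem l).updateMem (A.r_le l) H t hG (hs.entryMeasurable_U t l hG)
      (hs.entryMeasurable_V t l hG)
  exact ⟨EntryMeasurable.ofLayers fun l =>
    (entryMeasurable_layer h.x l).sub ((hmem l).direction.const_smul _), hmem⟩

theorem stateMeasurable_run (hm : ∀ x, Measurable (F x))
    (hd : ∀ z, Differentiable ℝ fun x => F x z) {svd : SVDRule A} (hs : svd.Valid) (H : Hyper)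
    (x0 : A.Params) {z : Ω → ℕ → ℕ → Ξ} (t : ℕ) (hz : ∀ i < t, ∀ b, Measurable fun ω => z ω i b) :
    StateMeasurable fun ω => run H F svd x0 (z ω) t := by
  induction t with
  | zero =>
    exact ⟨measurable_const, fun l => ⟨fun _ _ => measurable_const, fun _ _ => measurable_const,
      fun _ _ => measurable_const, fun _ _ => measurable_const⟩⟩
  | succ t ih =>
    exact (ih fun i hi => hz i (Nat.lt_succ_of_lt hi)).step hm hd hs H t (hz t t.lt_succ_self)

end Measurability

/-! ### GaLore as projected momentum descent -/

section Run

variable {A : Arch} {Ξ : Type*} {F : A.Params → Ξ → ℝ} {H : Hyper}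

theorem Hyper.batch_eq_of_switch {t : ℕ} (ht : t % H.τ = 0) : H.batch t = H.B := if_pos ht

theorem Hyper.one_le_batch (hB : 1 ≤ H.B) (t : ℕ) : 1 ≤ H.batch t := by
  unfold batch
  split_ifs
  exacts [hB, le_rfl]

theorem gradEstVec_eq_average (t : ℕ) (x : A.Params) (z : ℕ → Ξ) :
    gradEstVec H F t x z =
      (H.batch t : ℝ)⁻¹ • ∑ b ∈ Finset.range (H.batch t), gradient (fun y => F y (z b)) x := by
  ext ⟨l, i, j⟩
  by_cases ht : t % H.τ = 0 <;>
    simp [gradEstVec, gradEst, Hyper.batch, ofLayers, ht, layerGrad, layer, Matrix.sum_apply]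

theorem LSmooth.lipschitzWith {f : A.Params → ℝ} {L : ℝ≥0} (hf : LSmooth f L) :
    LipschitzWith L (gradient f) :=
  LipschitzWith.of_dist_le_mul fun x y => by simpa only [dist_eq_norm] using hf.2 x y

variable [MeasurableSpace Ξ] {D : Measure Ξ}

theorem gradEstVec_sub_gradient (hB : 1 ≤ H.B) (t : ℕ) (x : A.Params) (z : ℕ → Ξ) :
    gradEstVec H F t x z - gradient (objective D F) x =
      (H.batch t : ℝ)⁻¹ • ∑ b ∈ Finset.range (H.batch t), sampleNoise D F x (z b) := by
  have hbatch : (H.batch t : ℝ) ≠ 0 :=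
    Nat.cast_ne_zero.2 (Nat.one_le_iff_ne_zero.1 (H.one_le_batch hB t))
  simp only [gradEstVec_eq_average, sampleNoise, Finset.sum_sub_distrib, Finset.sum_const,
    Finset.card_range, smul_sub, ← Nat.cast_smul_eq_nsmul ℝ, inv_smul_smul₀ hbatch]

variable {Ω : Type*} {svd : SVDRule A} {x0 : A.Params} {ξ : ℕ → ℕ → Ω → Ξ}

/-- The projections and momenta held before iteration `t`, as a random variable. -/
noncomputable def memory (H : Hyper) (F : A.Params → Ξ → ℝ) (svd : SVDRule A) (x0 : A.Params)
    (ξ : ℕ → ℕ → Ω → Ξ) (t : ℕ) (ω : Ω) : A.Memory :=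
  (run H F svd x0 (fun s b => ξ s b ω) t).mem

/-- The error of the gradient estimate of iteration `t`, as a random variable. -/
noncomputable def gradNoise (D : Measure Ξ) (H : Hyper) (F : A.Params → Ξ → ℝ) (svd : SVDRule A)
    (x0 : A.Params) (ξ : ℕ → ℕ → Ω → Ξ) (t : ℕ) (ω : Ω) : A.Params :=
  gradEstVec H F t (iterate H F svd x0 ξ t ω) (fun b => ξ t b ω) -
    gradient (objective D F) (iterate H F svd x0 ξ t ω)

/-- The indices of the samples drawn in iteration `t`. -/
def Hyper.batchIndices (H : Hyper) (t : ℕ) : Finset (ℕ × ℕ) := {t} ×ˢ Finset.range (H.batch t)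

theorem Hyper.card_batchIndices (t : ℕ) : (H.batchIndices t).card = H.batch t := by
  simp [batchIndices]

theorem Hyper.fst_of_mem_batchIndices {t : ℕ} {i : ℕ × ℕ} (hi : i ∈ H.batchIndices t) :
    i.1 = t :=
  Finset.mem_singleton.1 (Finset.mem_product.1 hi).1

theorem gradNoise_eq_average (hB : 1 ≤ H.B) (t : ℕ) :
    gradNoise D H F svd x0 ξ t = (H.batch t : ℝ)⁻¹ • fun ω =>
      ∑ i ∈ H.batchIndices t, sampleNoise D F (iterate H F svd x0 ξ t ω) (ξ i.1 i.2 ω) := by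
  funext ω
  simp only [gradNoise, gradEstVec_sub_gradient hB, Hyper.batchIndices, Finset.sum_product,
    Finset.sum_singleton, Pi.smul_apply]

/-- The `σ`-algebra generated by the samples drawn before iteration `t`. -/
@[reducible]
def pastAlgebra (ξ : ℕ → ℕ → Ω → Ξ) (t : ℕ) : MeasurableSpace Ω :=
  sampleAlgebra (fun i : ℕ × ℕ => ξ i.1 i.2) {i | i.1 < t}

theorem pastAlgebra_mono : Monotone (pastAlgebra ξ) := fun _ _ h =>
  sampleAlgebra_mono fun _ hi => lt_of_lt_of_le hi h

theorem stateMeasurable_run_pastAlgebra (hm : ∀ x, Measurable (F x))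
    (hd : ∀ z, Differentiable ℝ fun x => F x z) (hs : svd.Valid) {i j : ℕ} (hij : i ≤ j) :
    StateMeasurable (mΩ := pastAlgebra ξ j) fun ω => run H F svd x0 (fun s b => ξ s b ω) i :=
  stateMeasurable_run (mΩ := pastAlgebra ξ j) hm hd hs H x0 i fun k hk b =>
    measurable_sampleAlgebra (ζ := fun i : ℕ × ℕ => ξ i.1 i.2) (i := (k, b)) (hk.trans_le hij)

theorem measurable_iterate (hm : ∀ x, Measurable (F x))
    (hd : ∀ z, Differentiable ℝ fun x => F x z) (hs : svd.Valid) (t : ℕ) :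
    Measurable[pastAlgebra ξ t] (iterate H F svd x0 ξ t) :=
  StateMeasurable.x (mΩ := pastAlgebra ξ t) (stateMeasurable_run_pastAlgebra hm hd hs le_rfl)

theorem measurable_memProj_memory (hm : ∀ x, Measurable (F x))
    (hd : ∀ z, Differentiable ℝ fun x => F x z) (hs : svd.Valid) {i j : ℕ} (hij : i ≤ j)
    {v : Ω → A.Params} (hv : Measurable[pastAlgebra ξ j] v) :
    Measurable[pastAlgebra ξ j] fun ω => memProj (memory H F svd x0 ξ i ω) (v ω) :=
  measurable_memProj (mΩ := pastAlgebra ξ j)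
    (StateMeasurable.mem (mΩ := pastAlgebra ξ j) (stateMeasurable_run_pastAlgebra hm hd hs hij)) hv

variable [mΩ : MeasurableSpace Ω] {μ : Measure Ω}

theorem IIDSamples.measurePreserving (hξ : IIDSamples D μ ξ) (i : ℕ × ℕ) :
    MeasurePreserving (ξ i.1 i.2) μ D :=
  ⟨hξ.measurable i.1 i.2, hξ.law i.1 i.2⟩

/-- The filtration whose `t`-th term is generated by the samples drawn before iteration `t`. -/
def pastFiltration (hξ : IIDSamples D μ ξ) : Filtration ℕ mΩ where
  seq := pastAlgebra ξ
  mono' := pastAlgebra_mono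
  le' _ := sampleAlgebra_le (fun i : ℕ × ℕ => hξ.measurable i.1 i.2) _

section GradNoise

variable [IsProbabilityMeasure μ] [IsProbabilityMeasure D] {σ : Fin A.N → ℝ}
  (hF : StochasticGradient D F σ) (hc : Continuous (gradient (objective D F)))
  (hs : svd.Valid) (hξ : IIDSamples D μ ξ) (hB : 1 ≤ H.B) (t : ℕ)

include hF hc hs hξ hB

theorem memL2_gradNoise : MemL2 (pastAlgebra ξ (t + 1)) μ (gradNoise D H F svd x0 ξ t) := by
  rw [gradNoise_eq_average hB]
  refine (((centeredNoise_sampleNoise hF hc).memL2_sum_comp hξ.measurePreserving hξ.indep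
    (fun i hi => (Hyper.fst_of_mem_batchIndices hi).not_lt)
    (measurable_iterate hF.measurable hF.differentiable hs t)).const_smul
      _).mono (sampleAlgebra_mono ?_)
  rintro i (hi | hi)
  · exact Nat.lt_succ_of_lt hi
  · exact (Hyper.fst_of_mem_batchIndices hi).trans_lt t.lt_succ_self

theorem integral_inner_gradNoise {Y : Ω → A.Params} (hY : MemL2 (pastAlgebra ξ t) μ Y) :
    ∫ ω, inner ℝ (Y ω) (gradNoise D H F svd x0 ξ t ω) ∂μ = 0 := by
  have horth := (centeredNoise_sampleNoise hF hc).integral_inner_sum hξ.measurePreserving hξ.indep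
    (fun i hi => (Hyper.fst_of_mem_batchIndices (H := H) hi).not_lt)
    (measurable_iterate (H := H) (x0 := x0) hF.measurable hF.differentiable hs t) hY
  simp only [gradNoise_eq_average hB, Pi.smul_apply, real_inner_smul_right, integral_const_mul]
  exact mul_eq_zero_of_right _ horth

theorem meanSq_gradNoise_le :
    meanSq μ (gradNoise D H F svd x0 ξ t) ≤ totalSigma σ ^ 2 / H.batch t := by
  have hbatch : (0 : ℝ) < H.batch t := Nat.cast_pos.2 (H.one_le_batch hB t)
  rw [gradNoise_eq_average hB, meanSq_const_smul]
  calc _ ≤ (H.batch t : ℝ)⁻¹ ^ 2 * ((H.batchIndices t).card * totalSigma σ ^ 2) := by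
        gcongr
        exact (centeredNoise_sampleNoise hF hc).meanSq_sum_le hξ.measurePreserving hξ.indep
          (fun i hi => (Hyper.fst_of_mem_batchIndices hi).not_lt)
          (measurable_iterate hF.measurable hF.differentiable hs t)
    _ = totalSigma σ ^ 2 / H.batch t := by
        rw [H.card_batchIndices]
        field_simp

end GradNoise

/-- A run of GaLore on random samples, as an instance of projected momentum descent. -/
noncomputable def toProjectedMomentum [IsProbabilityMeasure μ] [IsProbabilityMeasure D]
    {σ : Fin A.N → ℝ} {L : ℝ≥0} (hb : LowerBounded (objective D F))
    (hsm : LSmooth (objective D F) L) (hF : StochasticGradient D F σ) (hs : svd.Valid)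
    (hξ : IIDSamples D μ ξ) (x0 : A.Params) (hβ0 : 0 < H.β) (hβ1 : H.β ≤ 1) (hB : 1 ≤ H.B) :
    ProjectedMomentum μ A.Params where
  f := objective D F
  x₀ := x0
  L := L
  β := H.β
  η := H.η
  δ := A.minDelta
  s := totalSigma σ ^ 2
  N := totalSigma σ ^ 2 / H.B
  τ := H.τ
  X := iterate H F svd x0 ξ
  m t ω := memDirection (memory H F svd x0 ξ t ω)
  noise := gradNoise D H F svd x0 ξ
  p t ω := memProj (memory H F svd x0 ξ t ω)
  ℱ := pastFiltration hξ
  differentiable := hsm.1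
  lipschitz := hsm.lipschitzWith
  bddBelow := hb
  β_pos := hβ0
  β_le_one := hβ1
  δ_pos := A.minDelta_pos
  δ_le_one := A.minDelta_le_one
  X_zero _ := rfl
  m_zero _ := memDirection_run_zero
  p_zero _ := memProj_run_zero
  X_succ t _ := x_run_succ t
  m_succ t ω := by
    rw [gradNoise, add_sub_cancel]
    exact memDirection_run_succ hs.isSVD t
  isSymmetricProjection t _ := memProj_isSymmetricProjection (run_isPartialIsometry hs.isSVD t)
  p_succ _ _ ht := memProj_run_succ ht
  capture t ω ht := by
    rw [gradNoise, add_sub_cancel]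
    exact norm_gradEstVec_sub_memProj_sq_le hs.isSVD ht
  stronglyMeasurable_apply hij hv := (measurable_memProj_memory hF.measurable hF.differentiable hs
    hij hv.measurable).stronglyMeasurable
  memL2_noise := memL2_gradNoise hF hsm.lipschitzWith.continuous hs hξ hB
  integral_inner_noise t _ := integral_inner_gradNoise hF hsm.lipschitzWith.continuous hs hξ hB t
  meanSq_noise_le t :=
    (meanSq_gradNoise_le hF hsm.lipschitzWith.continuous hs hξ hB t).trans
      (div_le_self (sq_nonneg _) (Nat.one_le_cast.2 (H.one_le_batch hB t)))
  meanSq_noise_le_of_switch t ht := by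
    rw [← Hyper.batch_eq_of_switch ht]
    exact meanSq_gradNoise_le hF hsm.lipschitzWith.continuous hs hξ hB t

theorem sq_mul_le_of_le_sqrt {δ L η : ℝ} {τ : ℕ} (hδ : 0 ≤ δ) (hL : 0 < L) (hτ : 0 < τ)
    (hη0 : 0 ≤ η) (hη : η ≤ √(δ / (40 * (τ : ℝ) ^ 2 * L ^ 2))) :
    (η * L * τ) ^ 2 ≤ δ / 40 := by
  have hη_sq : η ^ 2 ≤ δ / (40 * (τ : ℝ) ^ 2 * L ^ 2) :=
    (Real.le_sqrt hη0 (by positivity)).1 hη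
  calc (η * L * τ) ^ 2 = η ^ 2 * (L ^ 2 * τ ^ 2) := by ring
    _ ≤ δ / (40 * (τ : ℝ) ^ 2 * L ^ 2) * (L ^ 2 * τ ^ 2) := by gcongr
    _ = δ / 40 := by field_simp

theorem avgGradSqLE_periods [IsProbabilityMeasure μ] [IsProbabilityMeasure D]
    {σ : Fin A.N → ℝ} {L : ℝ} (hL : 0 < L) (hb : LowerBounded (objective D F))
    (hsm : LSmooth (objective D F) L) (hF : StochasticGradient D F σ) (hs : svd.Valid)
    (hξ : IIDSamples D μ ξ) (x0 : A.Params) (hβ0 : 0 < H.β) (hβ1 : H.β ≤ 1)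
    (hτ : 64 / (3 * H.β * A.minDelta) ≤ (H.τ : ℝ)) (hη0 : 0 < H.η)
    (hη : H.η ≤ √(A.minDelta / (40 * (H.τ : ℝ) ^ 2 * L ^ 2))) (hB : 1 ≤ H.B) {K : ℕ}
    (hK : 1 ≤ K) :
    AvgGradSqLE μ (objective D F) (iterate H F svd x0 ξ) (K * H.τ)
      (8 * gap (objective D F) x0 / (A.minDelta * H.η * K * H.τ) +
        (64 / (A.minDelta ^ 2 * H.B) + 4 * H.β / A.minDelta) * totalSigma σ ^ 2) := by
  lift L to ℝ≥0 using hL.le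
  let P := toProjectedMomentum hb hsm hF hs hξ x0 hβ0 hβ1 hB
  have hδ := A.minDelta_pos
  have hτ0 : (0 : ℝ) < H.τ := lt_of_lt_of_le (by positivity) hτ
  have hsum := P.sum_meanSq_grad_le K hη0.le hτ
    (sq_mul_le_of_le_sqrt hδ.le hL (Nat.cast_pos.1 hτ0) hη0.le hη)
  have : (0 : ℝ) < K := Nat.cast_pos.2 hK
  have : (0 : ℝ) < H.B := Nat.cast_pos.2 hB
  refine ⟨fun t _ => integrable_norm_sq (P.memL2_grad t).memLp, ?_⟩
  change _ * ∑ t ∈ Finset.range (K * H.τ), meanSq μ (P.grad t) ≤ _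
  calc 1 / ((K * H.τ : ℕ) : ℝ) * ∑ t ∈ Finset.range (K * H.τ), meanSq μ (P.grad t)
      = 8 / (A.minDelta * H.η * K * H.τ) * (H.η * A.minDelta / 8 *
          ∑ t ∈ Finset.range (K * H.τ), meanSq μ (P.grad t)) := by
        push_cast
        field_simp
    _ ≤ 8 / (A.minDelta * H.η * K * H.τ) * (gap (objective D F) x0 + H.η / 2 *
          ((16 / A.minDelta * (totalSigma σ ^ 2 / H.B) + H.β * totalSigma σ ^ 2) *
            (K * H.τ))) :=
        mul_le_mul_of_nonneg_left hsum (by positivity)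
    _ = _ := by
        field_simp
        ring

end Run

/-! ### Hyperparameters for a given horizon -/

section Horizon

theorem rpow_div_two {δ : ℝ} (hδ : 0 ≤ δ) (k : ℕ) : δ ^ ((k : ℝ) / 2) = √δ ^ k := by
  rw [Real.sqrt_eq_rpow, ← Real.rpow_natCast, ← Real.rpow_mul hδ]
  congr 1
  ring

theorem rpow_five_halves {δ : ℝ} (hδ : 0 ≤ δ) : δ ^ (5 / 2 : ℝ) = δ * √δ ^ 3 := by
  calc δ ^ (5 / 2 : ℝ) = √δ ^ 5 := by rw [← rpow_div_two hδ, Nat.cast_ofNat]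
    _ = √δ ^ 2 * √δ ^ 3 := by ring
    _ = δ * √δ ^ 3 := by rw [Real.sq_sqrt hδ]

/-- The quantity `q = √(δ^(3/2) σ² T / (L Δ))`, for which `β = (1 + q)⁻¹`. -/
noncomputable def noiseRatio (δ L Δ σ : ℝ) (T : ℕ) : ℝ :=
  √(δ ^ (3 / 2 : ℝ) * σ ^ 2 * T / (L * Δ))

variable {δ L Δ σ : ℝ} {T : ℕ}

theorem noiseRatio_nonneg : 0 ≤ noiseRatio δ L Δ σ T := Real.sqrt_nonneg _

theorem noiseRatio_sq (hδ : 0 < δ) (hL : 0 < L) (hΔ : 0 < Δ) :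
    noiseRatio δ L Δ σ T ^ 2 = √δ ^ 3 * σ ^ 2 * T / (L * Δ) := by
  rw [noiseRatio, Real.sq_sqrt (by positivity), ← rpow_div_two hδ.le, Nat.cast_ofNat]

section Hyper

variable {H : Hyper} (hH : H = hyperFor δ L Δ σ T)

include hH

theorem hyperFor_beta : H.β = (1 + noiseRatio δ L Δ σ T)⁻¹ := by rw [hH]; rfl

theorem hyperFor_beta_pos : 0 < H.β := by
  rw [hyperFor_beta hH]
  exact inv_pos.2 (add_pos_of_pos_of_nonneg one_pos noiseRatio_nonneg)

theorem hyperFor_beta_le_one : H.β ≤ 1 := by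
  rw [hyperFor_beta hH]
  exact inv_le_one_of_one_le₀ (le_add_of_nonneg_right noiseRatio_nonneg)

theorem hyperFor_beta_mul_noiseRatio_le_one : H.β * noiseRatio δ L Δ σ T ≤ 1 := by
  have hq : 0 ≤ noiseRatio δ L Δ σ T := noiseRatio_nonneg
  rw [hyperFor_beta hH, inv_mul_le_iff₀ (by positivity)]
  linarith

theorem hyperFor_tau : H.τ = ⌈64 / (3 * δ * H.β)⌉₊ := by rw [hH]; rfl

theorem le_hyperFor_tau : 64 / (3 * H.β * δ) ≤ (H.τ : ℝ) := by
  rw [mul_right_comm, hyperFor_tau hH]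
  exact Nat.le_ceil _

theorem hyperFor_tau_lt (hδ : 0 < δ) : (H.τ : ℝ) < 64 / (3 * δ * H.β) + 1 := by
  have hβ := hyperFor_beta_pos hH
  rw [hyperFor_tau hH]
  exact Nat.ceil_lt_add_one (by positivity)

theorem hyperFor_tau_pos (hδ : 0 < δ) : 0 < H.τ := by
  have hβ := hyperFor_beta_pos hH
  rw [hyperFor_tau hH]
  exact Nat.ceil_pos.2 (by positivity)

theorem hyperFor_tau_le (hδ0 : 0 < δ) (hδ1 : δ ≤ 1) : (H.τ : ℝ) ≤ 23 / (δ * H.β) := by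
  have hβ := hyperFor_beta_pos hH
  have one_le : 1 ≤ 1 / (δ * H.β) :=
    one_le_one_div (by positivity) (mul_le_one₀ hδ1 hβ.le (hyperFor_beta_le_one hH))
  calc (H.τ : ℝ) ≤ 64 / (3 * δ * H.β) + 1 := (hyperFor_tau_lt hH hδ0).le
    _ = 64 / 3 * (1 / (δ * H.β)) + 1 := by field_simp
    _ ≤ 23 * (1 / (δ * H.β)) := by linarith
    _ = 23 / (δ * H.β) := by ring

theorem hyperFor_B : H.B = ⌈1 / (δ * H.β)⌉₊ := by rw [hH]; rfl

theorem one_le_hyperFor_B (hδ : 0 < δ) : 1 ≤ H.B := by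
  have hβ := hyperFor_beta_pos hH
  rw [hyperFor_B hH]
  exact Nat.ceil_pos.2 (by positivity)

theorem inv_hyperFor_B_le (hδ : 0 < δ) : (H.B : ℝ)⁻¹ ≤ δ * H.β := by
  have hβ := hyperFor_beta_pos hH
  have hB : 1 / (δ * H.β) ≤ H.B := by
    rw [hyperFor_B hH]
    exact Nat.le_ceil _
  rw [one_div] at hB
  exact inv_le_of_inv_le₀ (by positivity) hB

theorem hyperFor_B_le_tau (hδ : 0 < δ) : H.B ≤ H.τ := by
  have hβ := hyperFor_beta_pos hH
  rw [hyperFor_B hH, hyperFor_tau hH]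
  refine Nat.ceil_mono ?_
  rw [div_le_div_iff₀ (by positivity) (by positivity)]
  linarith [mul_pos hδ hβ]

theorem hyperFor_eta :
    H.η = (4 * L + √(80 * L ^ 2 / (3 * δ * H.β ^ 2)) + √(40 * (H.τ : ℝ) ^ 2 * L ^ 2 / δ) +
      √(32 * (H.τ : ℝ) * L ^ 2 / (3 * H.β)))⁻¹ := by
  rw [hH]; rfl

theorem hyperFor_eta_pos (hL : 0 < L) : 0 < H.η := by
  rw [hyperFor_eta hH]
  positivity

theorem hyperFor_eta_le (hδ : 0 < δ) (hL : 0 < L) :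
    H.η ≤ √(δ / (40 * (H.τ : ℝ) ^ 2 * L ^ 2)) := by
  have hτ : (0 : ℝ) < H.τ := Nat.cast_pos.2 (hyperFor_tau_pos hH hδ)
  have drift_pos : 0 < √(40 * (H.τ : ℝ) ^ 2 * L ^ 2 / δ) := Real.sqrt_pos.2 (by positivity)
  rw [hyperFor_eta hH, ← inv_div (40 * (H.τ : ℝ) ^ 2 * L ^ 2), Real.sqrt_inv]
  refine inv_anti₀ drift_pos ?_
  linarith [Real.sqrt_nonneg (80 * L ^ 2 / (3 * δ * H.β ^ 2)),
    Real.sqrt_nonneg (32 * (H.τ : ℝ) * L ^ 2 / (3 * H.β))]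

omit hH in
theorem sqrt_mul_sq_le {a c x : ℝ} (hc : 0 ≤ c) (hx : 0 ≤ x) (h : a ≤ c ^ 2) :
    √(a * x ^ 2) ≤ c * x := by
  refine Real.sqrt_le_iff.2 ⟨by positivity, ?_⟩
  rw [mul_pow]
  gcongr

theorem inv_hyperFor_eta_le (hδ0 : 0 < δ) (hδ1 : δ ≤ 1) (hL : 0 < L) :
    H.η⁻¹ ≤ 172 * (L / (√δ ^ 3 * H.β)) := by
  have hβ0 := hyperFor_beta_pos hH
  have hτ_le := hyperFor_tau_le hH hδ0 hδ1
  rw [hyperFor_eta hH, inv_inv]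
  obtain ⟨u, hu, rfl⟩ : ∃ u, 0 < u ∧ δ = u ^ 2 :=
    ⟨√δ, Real.sqrt_pos.2 hδ0, (Real.sq_sqrt hδ0.le).symm⟩
  have hu1 : u ≤ 1 := (sq_le_one_iff₀ hu.le).1 hδ1
  rw [Real.sqrt_sq hu.le]
  have hL_le : L ≤ L / (u ^ 3 * H.β) := le_div_self hL.le (by positivity)
    (mul_le_one₀ (pow_le_one₀ hu.le hu1) hβ0.le (hyperFor_beta_le_one hH))
  have hLuβ_le : L / (u * H.β) ≤ L / (u ^ 3 * H.β) := by
    gcongr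
    exact pow_le_of_le_one hu.le hu1 three_ne_zero
  have momentum_term : √(80 * L ^ 2 / (3 * u ^ 2 * H.β ^ 2)) ≤ 6 * (L / (u * H.β)) := by
    calc _ = √(80 / 3 * (L / (u * H.β)) ^ 2) := by congr 1; field_simp
      _ ≤ _ := sqrt_mul_sq_le (by norm_num) (by positivity) (by norm_num)
  have drift_term : √(40 * (H.τ : ℝ) ^ 2 * L ^ 2 / u ^ 2) ≤ 146 * (L / (u ^ 3 * H.β)) := by
    calc _ = √(40 * (H.τ * (L / u)) ^ 2) := by congr 1; field_simp
      _ ≤ 146 / 23 * (H.τ * (L / u)) :=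
        sqrt_mul_sq_le (by norm_num) (by positivity) (by norm_num)
      _ ≤ 146 / 23 * (23 / (u ^ 2 * H.β) * (L / u)) := by gcongr
      _ = 146 * (L / (u ^ 3 * H.β)) := by field_simp
  have mixed_term : √(32 * (H.τ : ℝ) * L ^ 2 / (3 * H.β)) ≤ 16 * (L / (u * H.β)) := by
    calc √(32 * (H.τ : ℝ) * L ^ 2 / (3 * H.β))
        ≤ √(32 * (23 / (u ^ 2 * H.β)) * L ^ 2 / (3 * H.β)) := by gcongr
      _ = √(736 / 3 * (L / (u * H.β)) ^ 2) := by
        congr 1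
        field_simp
        norm_num
      _ ≤ _ := sqrt_mul_sq_le (by norm_num) (by positivity) (by norm_num)
  linarith

end Hyper

section Rate

theorem sqrt_rate_eq (hδ : 0 < δ) (hL : 0 < L) (hΔ : 0 < Δ) (hT : 0 < T) :
    √(L * Δ * σ ^ 2 / (δ ^ (7 / 2 : ℝ) * T)) =
      L * Δ / (δ ^ (5 / 2 : ℝ) * T) * noiseRatio δ L Δ σ T := by
  have : (0 : ℝ) < T := Nat.cast_pos.2 hT
  have hq : 0 ≤ noiseRatio δ L Δ σ T := noiseRatio_nonneg
  rw [Real.sqrt_eq_iff_eq_sq (by positivity) (by positivity), mul_pow, noiseRatio_sq hδ hL hΔ]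
  have h5 : δ ^ (5 / 2 : ℝ) = √δ ^ 5 := by rw [← rpow_div_two hδ.le, Nat.cast_ofNat]
  have h7 : δ ^ (7 / 2 : ℝ) = √δ ^ 7 := by rw [← rpow_div_two hδ.le, Nat.cast_ofNat]
  have : 0 < √δ := Real.sqrt_pos.2 hδ
  rw [h5, h7]
  field_simp

variable {H : Hyper} (hH : H = hyperFor δ L Δ σ T)

include hH

theorem hyperFor_optimization_term_le (hδ0 : 0 < δ) (hδ1 : δ ≤ 1) (hL : 0 < L) (hΔ : 0 < Δ)
    (hT : 0 < T) :
    8 * Δ / (δ * H.η * T) ≤ 1376 * (L * Δ / (δ ^ (5 / 2 : ℝ) * T) +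
      √(L * Δ * σ ^ 2 / (δ ^ (7 / 2 : ℝ) * T))) := by
  have : (0 : ℝ) < T := Nat.cast_pos.2 hT
  have : 0 < √δ := Real.sqrt_pos.2 hδ0
  have hβ := hyperFor_beta_pos hH
  have hβ_inv : H.β⁻¹ = 1 + noiseRatio δ L Δ σ T := by rw [hyperFor_beta hH, inv_inv]
  rw [sqrt_rate_eq hδ0 hL hΔ hT]
  calc 8 * Δ / (δ * H.η * T) = 8 * Δ / (δ * T) * H.η⁻¹ := by field_simp
    _ ≤ 8 * Δ / (δ * T) * (172 * (L / (√δ ^ 3 * H.β))) := by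
        gcongr
        exact inv_hyperFor_eta_le hH hδ0 hδ1 hL
    _ = 1376 * (L * Δ / (δ ^ (5 / 2 : ℝ) * T)) * H.β⁻¹ := by
        rw [rpow_five_halves hδ0.le]
        field_simp
        norm_num
    _ = _ := by rw [hβ_inv]; ring

theorem hyperFor_beta_mul_sq_div_le (hδ : 0 < δ) (hL : 0 < L) (hΔ : 0 < Δ) (hT : 0 < T) :
    H.β * σ ^ 2 / δ ≤ √(L * Δ * σ ^ 2 / (δ ^ (7 / 2 : ℝ) * T)) := by
  have : (0 : ℝ) < T := Nat.cast_pos.2 hT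
  have : 0 < √δ := Real.sqrt_pos.2 hδ
  have hq : 0 ≤ noiseRatio δ L Δ σ T := noiseRatio_nonneg
  have hβq := hyperFor_beta_mul_noiseRatio_le_one hH
  rw [sqrt_rate_eq hδ hL hΔ hT]
  set q := noiseRatio δ L Δ σ T
  set W := L * Δ / (δ ^ (5 / 2 : ℝ) * T) with hW
  have : 0 ≤ W := by positivity
  have hσ : σ ^ 2 / δ = W * q ^ 2 := by
    rw [noiseRatio_sq hδ hL hΔ, hW, rpow_five_halves hδ.le]
    field_simp
  calc H.β * σ ^ 2 / δ = H.β * q * (W * q) := by rw [mul_div_assoc, hσ]; ring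
    _ ≤ 1 * (W * q) := by gcongr
    _ = W * q := one_mul _

theorem hyperFor_noise_term_le (hδ : 0 < δ) (hL : 0 < L) (hΔ : 0 < Δ) (hT : 0 < T) :
    (64 / (δ ^ 2 * H.B) + 4 * H.β / δ) * σ ^ 2 ≤
      68 * √(L * Δ * σ ^ 2 / (δ ^ (7 / 2 : ℝ) * T)) := by
  calc (64 / (δ ^ 2 * H.B) + 4 * H.β / δ) * σ ^ 2
      = (64 / δ ^ 2 * (H.B : ℝ)⁻¹ + 4 * H.β / δ) * σ ^ 2 := by ring
    _ ≤ (64 / δ ^ 2 * (δ * H.β) + 4 * H.β / δ) * σ ^ 2 := by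
        gcongr
        exact inv_hyperFor_B_le hH hδ
    _ = 68 * (H.β * σ ^ 2 / δ) := by
        field_simp
        ring
    _ ≤ _ := by
        gcongr
        exact hyperFor_beta_mul_sq_div_le hH hδ hL hΔ hT

theorem hyperFor_bound_le (hδ0 : 0 < δ) (hδ1 : δ ≤ 1) (hL : 0 < L) (hΔ : 0 < Δ) (hT : 0 < T)
    {K : ℕ} (hK : 0 < K) (hKT : K * H.τ ≤ 2 * T) :
    ((K * H.τ : ℕ) : ℝ) / T * (8 * Δ / (δ * H.η * K * H.τ) +
        (64 / (δ ^ 2 * H.B) + 4 * H.β / δ) * σ ^ 2) ≤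
      1512 * (L * Δ / (δ ^ (5 / 2 : ℝ) * T) + √(L * Δ * σ ^ 2 / (δ ^ (7 / 2 : ℝ) * T))) := by
  have hT0 : (0 : ℝ) < T := Nat.cast_pos.2 hT
  have : (0 : ℝ) < K := Nat.cast_pos.2 hK
  have hτ : (0 : ℝ) < H.τ := Nat.cast_pos.2 (hyperFor_tau_pos hH hδ0)
  have hratio : ((K * H.τ : ℕ) : ℝ) / T ≤ 2 := by
    rw [div_le_iff₀ hT0]
    exact_mod_cast hKT
  have hopt : ((K * H.τ : ℕ) : ℝ) / T * (8 * Δ / (δ * H.η * K * H.τ)) =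
      8 * Δ / (δ * H.η * T) := by
    push_cast
    field_simp
  have hnoise := mul_le_mul hratio (hyperFor_noise_term_le hH hδ0 hL hΔ hT)
    (mul_nonneg (by have := hyperFor_beta_pos hH; positivity) (sq_nonneg σ)) zero_le_two
  have rate_nonneg : 0 ≤ L * Δ / (δ ^ (5 / 2 : ℝ) * T) := by positivity
  rw [mul_add, hopt]
  linarith [hyperFor_optimization_term_le hH hδ0 hδ1 hL hΔ hT]

end Rate

theorem exists_periods {T τ : ℕ} (hτ : 0 < τ) (h : τ ≤ T) :
    ∃ K, 0 < K ∧ T ≤ K * τ ∧ K * τ ≤ 2 * T := by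
  refine ⟨T / τ + 1, Nat.succ_pos _, ?_, ?_⟩
  · have := Nat.lt_div_mul_add (a := T) hτ
    linarith
  · have := Nat.div_mul_le_self T τ
    linarith

namespace LongHorizon

theorem pos (h : LongHorizon δ L Δ σ T) (hδ : 0 < δ) (hL : 0 < L) (hΔ : 0 < Δ) : 0 < T := by
  unfold LongHorizon at h
  have hT : (0 : ℝ) < T := lt_of_lt_of_le (by positivity) h
  exact Nat.cast_pos.1 hT

theorem tau_le (h : LongHorizon δ L Δ σ T) (hδ : 0 < δ) (hL : 0 < L) (hΔ : 0 < Δ) :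
    (hyperFor δ L Δ σ T).τ ≤ T := by
  unfold LongHorizon at h
  set b := (128 * σ) ^ 2 / (9 * √δ * L * Δ) with hb
  have hb0 : 0 ≤ b := by positivity
  have hτ : ((hyperFor δ L Δ σ T).τ : ℝ) <
      64 / (3 * δ) + 64 / (3 * δ) * noiseRatio δ L Δ σ T + 1 := by
    refine (hyperFor_tau_lt rfl hδ).trans_eq ?_
    rw [hyperFor_beta rfl]
    field_simp
  have hsq : (64 / (3 * δ) * noiseRatio δ L Δ σ T) ^ 2 = b * T / 4 := by
    have : 0 < √δ := Real.sqrt_pos.2 hδ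
    rw [mul_pow, noiseRatio_sq hδ hL hΔ, hb]
    nth_rewrite 1 [← Real.sq_sqrt hδ.le]
    field_simp
    ring
  have amgm : 64 / (3 * δ) * noiseRatio δ L Δ σ T ≤ (b + T) / 4 := by
    refine le_of_sq_le_sq ?_ (by positivity)
    rw [hsq]
    linarith [sq_nonneg (b - T)]
  have hhalf : 64 / (3 * δ) = 128 / (3 * δ) / 2 := by ring
  have hδ_pos : 0 < 128 / (3 * δ) := by positivity
  have : ((hyperFor δ L Δ σ T).τ : ℝ) ≤ T := by linarith
  exact_mod_cast this

theorem gradEvals_le (h : LongHorizon δ L Δ σ T) (hδ : 0 < δ) (hL : 0 < L) (hΔ : 0 < Δ) :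
    ((hyperFor δ L Δ σ T).gradEvals T : ℝ) ≤ 3 * T := by
  have τ_pos : 0 < (hyperFor δ L Δ σ T).τ := hyperFor_tau_pos rfl hδ
  have τ_le := h.tau_le hδ hL hΔ
  have B_le : (hyperFor δ L Δ σ T).B ≤ (hyperFor δ L Δ σ T).τ := hyperFor_B_le_tau rfl hδ
  set H := hyperFor δ L Δ σ T
  obtain ⟨K, -, hTK, hKT⟩ := exists_periods τ_pos τ_le
  have batch_le (t : ℕ) : H.batch t ≤ 1 + if t % H.τ = 0 then H.B else 0 := by
    unfold Hyper.batch
    split_ifs <;> omega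
  have gradEvals_le : H.gradEvals T ≤ 3 * T := calc
    H.gradEvals T ≤ ∑ t ∈ Finset.range T, (1 + if t % H.τ = 0 then H.B else 0) :=
        Finset.sum_le_sum fun t _ => batch_le t
    _ = T + ∑ t ∈ Finset.range T, (if t % H.τ = 0 then H.B else 0) := by
        rw [Finset.sum_add_distrib, Finset.sum_const, Finset.card_range, smul_eq_mul, mul_one]
    _ ≤ T + ∑ t ∈ Finset.range (K * H.τ), (if t % H.τ = 0 then H.B else 0) := by gcongr
    _ = T + K * H.B := by
        rw [sum_range_mul_ite_mod_eq_zero _ K τ_pos, Finset.sum_const, Finset.card_range,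
          smul_eq_mul]
    _ ≤ T + K * H.τ := by gcongr
    _ ≤ 3 * T := by omega
  exact_mod_cast gradEvals_le

end LongHorizon

theorem longHorizon_iff : LongHorizon δ L Δ σ T ↔
    2 + 128 / 3 * (1 / δ) + 16384 / 9 * (σ ^ 2 / (√δ * L * Δ)) ≤ T := by
  rw [LongHorizon, div_mul_div_comm, div_mul_div_comm, mul_one, mul_pow, ← mul_assoc, ← mul_assoc]
  norm_num

theorem mul_div_add_sqrt_div_le {a b c ε T : ℝ} (hc : 0 < c) (hε : 0 < ε) (hT : 0 < T)
    (ha : 2 * c * (a / ε) ≤ T) (hb : 4 * c ^ 2 * (b / ε ^ 2) ≤ T) :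
    c * (a / T + √(b / T)) ≤ ε := by
  have linear_le : a / T ≤ ε / (2 * c) := by
    rw [← mul_div_assoc, div_le_iff₀ hε] at ha
    rw [div_le_div_iff₀ hT (by positivity)]
    linarith
  have sqrt_le : √(b / T) ≤ ε / (2 * c) := by
    rw [← mul_div_assoc, div_le_iff₀ (by positivity)] at hb
    rw [Real.sqrt_le_left (by positivity), div_pow, div_le_div_iff₀ hT (by positivity)]
    linarith
  calc c * (a / T + √(b / T)) ≤ c * (ε / (2 * c) + ε / (2 * c)) := by gcongr
    _ = ε := by field_simp; norm_num

theorem exists_longHorizon_rate_le {c ε : ℝ} (hc : 22 ≤ c) (hδ0 : 0 < δ) (hδ1 : δ ≤ 1)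
    (hL : 0 < L) (hΔ : 0 < Δ) (hε : 0 < ε) :
    ∃ T : ℕ, LongHorizon δ L Δ σ T ∧
      c * (L * Δ / (δ ^ (5 / 2 : ℝ) * T) + √(L * Δ * σ ^ 2 / (δ ^ (7 / 2 : ℝ) * T))) ≤ ε ∧
      3 * (T : ℝ) ≤ 12 * c ^ 2 * (L * Δ * σ ^ 2 / (δ ^ (7 / 2 : ℝ) * ε ^ 2) +
        L * Δ / (δ ^ (5 / 2 : ℝ) * ε) + σ ^ 2 / (δ ^ (1 / 2 : ℝ) * L * Δ) + 1 / δ) := by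
  have hc0 : 0 < c := by linarith
  simp only [← Real.sqrt_eq_rpow, ← div_div _ (δ ^ (5 / 2 : ℝ)), ← div_div _ (δ ^ (7 / 2 : ℝ))]
  set V := L * Δ * σ ^ 2 / δ ^ (7 / 2 : ℝ)
  set W := L * Δ / δ ^ (5 / 2 : ℝ)
  set b := σ ^ 2 / (√δ * L * Δ)
  have : 0 ≤ V / ε ^ 2 := by positivity
  have hW0 : 0 ≤ W / ε := by positivity
  have hb0 : 0 ≤ b := by positivity
  have one_le_inv : 1 ≤ 1 / δ := one_le_one_div hδ0 hδ1
  set T₀ := 2 + 128 / 3 * (1 / δ) + 16384 / 9 * b + 2 * c * (W / ε) + 4 * c ^ 2 * (V / ε ^ 2)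
    with hT₀
  have hT₀_pos : 0 < T₀ := by positivity
  have le_T : T₀ ≤ ⌈T₀⌉₊ := Nat.le_ceil T₀
  have T_lt : (⌈T₀⌉₊ : ℝ) < T₀ + 1 := Nat.ceil_lt_add_one hT₀_pos.le
  have hcW : 0 ≤ c * (W / ε) := by positivity
  have hcV : 0 ≤ c ^ 2 * (V / ε ^ 2) := by positivity
  refine ⟨⌈T₀⌉₊, ?_, mul_div_add_sqrt_div_le hc0 hε (hT₀_pos.trans_le le_T) ?_ ?_, ?_⟩
  · rw [longHorizon_iff]
    linarith
  · linarith
  · linarith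
  · have hc_sq : 22 ^ 2 ≤ c ^ 2 := pow_le_pow_left₀ (by norm_num) hc 2
    have hc_le : c ≤ c ^ 2 := by nlinarith
    have hW' := mul_le_mul_of_nonneg_right hc_le hW0
    have hb' := mul_le_mul_of_nonneg_right hc_sq hb0
    have hδ' := mul_le_mul_of_nonneg_right hc_sq (zero_le_one.trans one_le_inv)
    linarith

end Horizon

/-! ### Convergence -/

section Convergence

variable {A : Arch} {Ω : Type*} [MeasurableSpace Ω] {μ : Measure Ω}

section AvgGradSqLE

variable {f : A.Params → ℝ} {X : ℕ → Ω → A.Params} {T : ℕ} {a b : ℝ}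

theorem AvgGradSqLE.mono (h : AvgGradSqLE μ f X T a) (hab : a ≤ b) : AvgGradSqLE μ f X T b :=
  ⟨h.1, h.2.trans hab⟩

theorem AvgGradSqLE.of_le {T' : ℕ} (h : AvgGradSqLE μ f X T' a) (hT : 0 < T) (hTT' : T ≤ T') :
    AvgGradSqLE μ f X T ((T' : ℝ) / T * a) := by
  refine ⟨fun t ht => h.1 t (ht.trans_le hTT'), ?_⟩
  have : (0 : ℝ) < T := Nat.cast_pos.2 hT
  have hT'0 : (0 : ℝ) < T' := Nat.cast_pos.2 (hT.trans_le hTT')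
  have sum_le : ∑ t ∈ Finset.range T, ∫ ω, ‖gradient f (X t ω)‖ ^ 2 ∂μ ≤
      ∑ t ∈ Finset.range T', ∫ ω, ‖gradient f (X t ω)‖ ^ 2 ∂μ :=
    Finset.sum_le_sum_of_subset_of_nonneg (Finset.range_mono hTT') fun t _ _ =>
      integral_nonneg fun _ => sq_nonneg _
  calc _ ≤ 1 / (T : ℝ) * ∑ t ∈ Finset.range T', ∫ ω, ‖gradient f (X t ω)‖ ^ 2 ∂μ := by gcongr
    _ = (T' : ℝ) / T *
        (1 / (T' : ℝ) * ∑ t ∈ Finset.range T', ∫ ω, ‖gradient f (X t ω)‖ ^ 2 ∂μ) := by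
        field_simp
    _ ≤ _ := mul_le_mul_of_nonneg_left h.2 (by positivity)

end AvgGradSqLE

theorem gap_nonneg {f : A.Params → ℝ} (hf : LowerBounded f) (x : A.Params) : 0 ≤ gap f x :=
  sub_nonneg.2 (ciInf_le hf x)

theorem bound_periods_le {β δ Δ η σ : ℝ} {B K τ : ℕ} (hβ : 0 ≤ β) (hδ : 0 ≤ δ) (hΔ : 0 ≤ Δ)
    (hη : 0 ≤ η) :
    8 * Δ / (δ * η * K * τ) + (64 / (δ ^ 2 * B) + 4 * β / δ) * σ ^ 2 ≤
      16 * Δ / (δ * η * K * τ) +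
        (160 / (3 * β * δ * τ * B) + 352 / (3 * δ ^ 2 * B) + 32 * β / (3 * δ)) * σ ^ 2 := by
  have batch_term : 64 / (δ ^ 2 * B) ≤ 352 / (3 * δ ^ 2 * B) := calc
    64 / (δ ^ 2 * B) = 192 / (3 * δ ^ 2 * B) := by rw [mul_assoc 3, ← div_div 192]; norm_num
    _ ≤ _ := by gcongr; norm_num
  have momentum_term : 4 * β / δ ≤ 32 * β / (3 * δ) := calc
    4 * β / δ = 12 * β / (3 * δ) := by rw [← div_div, mul_div_right_comm 12]; norm_num
    _ ≤ _ := by gcongr; norm_num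
  have switch_term : 0 ≤ 160 / (3 * β * δ * τ * B) := by positivity
  gcongr
  · norm_num
  · linarith

variable {Ξ : Type*} [MeasurableSpace Ξ] {D : Measure Ξ} [IsProbabilityMeasure D]
  {F : A.Params → Ξ → ℝ} {L : ℝ} {σ : Fin A.N → ℝ} {svd : SVDRule A} [IsProbabilityMeasure μ]
  {ξ : ℕ → ℕ → Ω → Ξ}

theorem avgGradSqLE_horizon (hL : 0 < L) (hb : LowerBounded (objective D F))
    (hsm : LSmooth (objective D F) L) (hF : StochasticGradient D F σ) (hs : svd.Valid)
    (hξ : IIDSamples D μ ξ) (x0 : A.Params) (hΔ : 0 < gap (objective D F) x0) {T : ℕ}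
    (hT : LongHorizon A.minDelta L (gap (objective D F) x0) (totalSigma σ) T) :
    AvgGradSqLE μ (objective D F)
      (iterate (hyperFor A.minDelta L (gap (objective D F) x0) (totalSigma σ) T) F svd x0 ξ) T
      (1512 * (L * gap (objective D F) x0 / (A.minDelta ^ (5 / 2 : ℝ) * T) +
        √(L * gap (objective D F) x0 * totalSigma σ ^ 2 / (A.minDelta ^ (7 / 2 : ℝ) * T)))) := by
  have hδ0 := A.minDelta_pos
  have hδ1 := A.minDelta_le_one
  have T_pos := hT.pos hδ0 hL hΔ
  obtain ⟨K, hK, hTK, hKT⟩ := exists_periods (hyperFor_tau_pos rfl hδ0) (hT.tau_le hδ0 hL hΔ)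
  have periods := avgGradSqLE_periods
    (H := hyperFor A.minDelta L (gap (objective D F) x0) (totalSigma σ) T)
    hL hb hsm hF hs hξ x0 (hyperFor_beta_pos rfl) (hyperFor_beta_le_one rfl) (le_hyperFor_tau rfl)
    (hyperFor_eta_pos rfl hL) (hyperFor_eta_le rfl hδ0 hL) (one_le_hyperFor_B rfl hδ0) hK
  exact (periods.of_le T_pos hTK).mono (hyperFor_bound_le rfl hδ0 hδ1 hL hΔ T_pos hK hKT)

end Convergence

end GaLore

theorem theorem3 :
    ∃ C : ℝ, 0 < C ∧
      ∀ (A : GaLore.Arch)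
        (Ξ : Type*) [MeasurableSpace Ξ] (D : Measure Ξ) [IsProbabilityMeasure D]
        (F : A.Params → Ξ → ℝ) (L : ℝ) (σ : Fin A.N → ℝ) (x0 : A.Params)
        (svd : GaLore.SVDRule A)
        (Ω : Type*) [MeasurableSpace Ω] (μ : Measure Ω) [IsProbabilityMeasure μ]
        (ξ : ℕ → ℕ → Ω → Ξ),
        0 < L → (∀ l, 0 ≤ σ l) →
        GaLore.LowerBounded (GaLore.objective D F) →
        GaLore.LSmooth (GaLore.objective D F) L →
        GaLore.StochasticGradient D F σ →
        svd.Valid →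
        GaLore.IIDSamples D μ ξ →
        -- explicit bound after `K` periods, for a range of hyperparameters
        (∀ (H : GaLore.Hyper) (K : ℕ),
          0 < H.β → H.β ≤ 1 →
          64 / (3 * H.β * A.minDelta) ≤ (H.τ : ℝ) →
          0 < H.η →
          H.η ≤ 1 / (4 * L) →
          H.η ≤ Real.sqrt (3 * A.minDelta * H.β ^ 2 / (80 * L ^ 2)) →
          H.η ≤ Real.sqrt (A.minDelta / (40 * (H.τ : ℝ) ^ 2 * L ^ 2)) →
          H.η ≤ Real.sqrt (3 * H.β / (32 * (H.τ : ℝ) * L ^ 2)) →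
          1 ≤ H.B → 1 ≤ K →
          GaLore.AvgGradSqLE μ (GaLore.objective D F) (GaLore.iterate H F svd x0 ξ) (K * H.τ)
            (16 * GaLore.gap (GaLore.objective D F) x0 / (A.minDelta * H.η * K * H.τ) +
              (160 / (3 * H.β * A.minDelta * H.τ * H.B) +
                352 / (3 * A.minDelta ^ 2 * H.B) +
                32 * H.β / (3 * A.minDelta)) * GaLore.totalSigma σ ^ 2)) ∧
        -- the rate with the hyperparameters chosen for the horizon `T`
        (0 < GaLore.gap (GaLore.objective D F) x0 →
          ∀ T : ℕ,
          GaLore.LongHorizon A.minDelta L (GaLore.gap (GaLore.objective D F) x0)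
            (GaLore.totalSigma σ) T →
          GaLore.AvgGradSqLE μ (GaLore.objective D F)
            (GaLore.iterate
              (GaLore.hyperFor A.minDelta L (GaLore.gap (GaLore.objective D F) x0)
                (GaLore.totalSigma σ) T) F svd x0 ξ) T
            (C * (L * GaLore.gap (GaLore.objective D F) x0 / (A.minDelta ^ (5 / 2 : ℝ) * T) +
              Real.sqrt (L * GaLore.gap (GaLore.objective D F) x0 * GaLore.totalSigma σ ^ 2 /
                (A.minDelta ^ (7 / 2 : ℝ) * T))))) ∧
        -- the number of stochastic gradients that suffices for accuracy `ε`
        (0 < GaLore.gap (GaLore.objective D F) x0 →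
          ∀ ε : ℝ, 0 < ε →
          ∃ T : ℕ,
            GaLore.LongHorizon A.minDelta L (GaLore.gap (GaLore.objective D F) x0)
              (GaLore.totalSigma σ) T ∧
            GaLore.AvgGradSqLE μ (GaLore.objective D F)
              (GaLore.iterate
                (GaLore.hyperFor A.minDelta L (GaLore.gap (GaLore.objective D F) x0)
                  (GaLore.totalSigma σ) T) F svd x0 ξ) T ε ∧
            ((GaLore.hyperFor A.minDelta L (GaLore.gap (GaLore.objective D F) x0)
                (GaLore.totalSigma σ) T).gradEvals T : ℝ) ≤
              C * (L * GaLore.gap (GaLore.objective D F) x0 * GaLore.totalSigma σ ^ 2 /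
                    (A.minDelta ^ (7 / 2 : ℝ) * ε ^ 2) +
                  L * GaLore.gap (GaLore.objective D F) x0 / (A.minDelta ^ (5 / 2 : ℝ) * ε) +
                  GaLore.totalSigma σ ^ 2 /
                    (A.minDelta ^ (1 / 2 : ℝ) * L * GaLore.gap (GaLore.objective D F) x0) +
                  1 / A.minDelta)) := by
  refine ⟨12 * 1512 ^ 2, by norm_num, ?_⟩
  intro A Ξ _ D _ F L σ x0 svd Ω _ μ _ ξ hL _ hb hsm hF hs hξ
  have hδ0 := A.minDelta_pos
  refine ⟨fun H K hβ0 hβ1 hτ hη0 _ _ hη _ hB hK => ?_, fun hΔ T hT => ?_, fun hΔ ε hε => ?_⟩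
  · exact (GaLore.avgGradSqLE_periods hL hb hsm hF hs hξ x0 hβ0 hβ1 hτ hη0 hη hB hK).mono
      (GaLore.bound_periods_le hβ0.le hδ0.le (GaLore.gap_nonneg hb x0) hη0.le)
  · exact (GaLore.avgGradSqLE_horizon hL hb hsm hF hs hξ x0 hΔ hT).mono
      (mul_le_mul_of_nonneg_right (by norm_num) (by positivity))
  · obtain ⟨T, hT, rate_le, evals_le⟩ := GaLore.exists_longHorizon_rate_le
      (c := 1512) (σ := GaLore.totalSigma σ) (by norm_num) hδ0 A.minDelta_le_one hL hΔ hε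
    exact ⟨T, hT, (GaLore.avgGradSqLE_horizon hL hb hsm hF hs hξ x0 hΔ hT).mono rate_le,
      (hT.gradEvals_le hδ0 hL hΔ).trans evals_le⟩
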